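/- Let $0<q<1$. Write $(a;q)_\infty=\prod_{k\ge 0}(1-aq^k)$, $[n]=\frac{1-q^n}{1-q}$, $[n]!=[1][2]\cdots[n]$ (with $[0]!=1$), and let $$E_q(z)=(-(1-q)z;q)_\infty\ (z\in\mathbb C),\qquad e_q(z)=\frac{1}{((1-q)z;q)_\infty}\ (|(1-q)z|<1),\qquad \mathrm{Sin}_q z=\frac{E_q(iz)-E_q(-iz)}{2i}.$$ Define the $q$-Bernoulli polynomials $b_n(x;q)$ by the expansion, for $t$ near $0$, $$\frac{t\,e_q(tx)}{e_q(t/2)E_q(t/2)-1}=\sum_{n=0}^\infty b_n(x;q)\frac{t^n}{[n]!}.$$ The positive zeros of $\mathrm{Sin}_q$ form an infinite strictly increasing sequence $\xi_1<\xi_2<\cdots$, they are simple, and for every $s\in\mathbb C$ the series $$\eta_q(s)=-\sum_{k=1}^\infty \frac{1}{\mathrm{Sin}_q'(\xi_k)}\,\frac{1}{\xi_k^{s}}$$ converges absolutely. Moreover $$\eta_q(2n)=2^{2n-1}(-1)^n\,\frac{b_{2n}(1/2;q)}{[2n]!}\quad (n=0,1,2,\dots),\qquad \eta_q(-2n)=0\quad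 (n=1,2,3,\dots).$$ -/

import Mathlib

noncomputable section

/-- The infinite `q`-shifted factorial `(a; q)_∞ = ∏_{k ≥ 0} (1 - a q^k)`. -/
def qPochInf (a : ℂ) (q : ℝ) : ℂ := ∏' k : ℕ, (1 - a * (q : ℂ) ^ k)

/-- The `q`-exponential `E_q(z) = (-(1 - q) z; q)_∞`. -/
def qExpE (q : ℝ) (z : ℂ) : ℂ := qPochInf (-((1 - (q : ℂ)) * z)) q

/-- The `q`-exponential `e_q(z) = 1 / ((1 - q) z; q)_∞`, for `|(1 - q) z| < 1`. -/
def qExpe (q : ℝ) (z : ℂ) : ℂ := 1 / qPochInf ((1 - (q : ℂ)) * z) q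

/-- Jackson's `q`-sine `Sin_q z = (E_q(iz) - E_q(-iz)) / (2i)`. -/
def qSin (q : ℝ) (z : ℂ) : ℂ :=
  (qExpE q (Complex.I * z) - qExpE q (-(Complex.I * z))) / (2 * Complex.I)

/-- The `q`-number `[n] = (1 - q^n) / (1 - q)`. -/
def qNumber (q : ℝ) (n : ℕ) : ℝ := (1 - q ^ n) / (1 - q)

/-- The `q`-factorial `[n]! = [1] [2] ⋯ [n]`. -/
def qFact (q : ℝ) (n : ℕ) : ℝ := ∏ k ∈ Finset.Icc 1 n, qNumber q k

/-- The generating function `t e_q(tx) / (e_q(t/2) E_q(t/2) - 1)`; its singularity at `t = 0` is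
removable and the value there is the limit `1`. -/
def qBernoulliGen (q : ℝ) (x t : ℂ) : ℂ :=
  if t = 0 then 1 else t * qExpe q (t * x) / (qExpe q (t / 2) * qExpE q (t / 2) - 1)

/-- The `q`-Bernoulli polynomial `b_n(x; q)`: `b_n(x; q) / [n]!` is the `n`-th Taylor coefficient
at `t = 0` of the generating function `t e_q(tx) / (e_q(t/2) E_q(t/2) - 1)`. -/
def qBernoulliPoly (q : ℝ) (n : ℕ) (x : ℂ) : ℂ :=
  (qFact q n : ℂ) * (iteratedDeriv n (qBernoulliGen q x) 0 / (n.factorial : ℂ))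

/-- `qSinZero q k` is, for `k ≥ 1`, the `k`-th positive zero `ξ_k` of `Sin_q` in increasing order:
`ξ_0 = 0`, and `ξ_{k+1}` is the smallest zero of `Sin_q` that exceeds `ξ_k`. -/
def qSinZero (q : ℝ) : ℕ → ℝ
  | 0 => 0
  | k + 1 => sInf {x : ℝ | qSinZero q k < x ∧ qSin q (x : ℂ) = 0}

/-- The term of index `k + 1` of the series of `η_q(s)`, without its sign:
`1 / (Sin_q'(ξ_{k+1}) ξ_{k+1}^s)`. -/
def qEtaTerm (q : ℝ) (s : ℂ) (k : ℕ) : ℂ :=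
  1 / deriv (qSin q) (qSinZero q (k + 1) : ℂ) * (1 / (qSinZero q (k + 1) : ℂ) ^ s)

/-- The `q`-eta function `η_q(s) = -∑_{k ≥ 1} 1 / (Sin_q'(ξ_k) ξ_k^s)`. -/
def qEta (q : ℝ) (s : ℂ) : ℂ := -∑' k : ℕ, qEtaTerm q s k

end

namespace QEta
open Filter Topology

/-! Everything is a residue computation for z / Sin_q z. Since e_q(t/2) = 1 / E_q(-t/2), at x = 1/2
the generating function collapses to t / (E_q(t/2) - E_q(-t/2)) = w / Sin_q w with w = -it/2
(`qBernoulliGen_half_eventuallyEq`), so b_{2n}(1/2) is read off from the Taylor coefficients of z /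
Sin_q z. Integrate z^m · z / Sin_q z over circles whose radii tend to infinity between the zeros. As
Sin_q' is even, for odd m the residues at ξ_k and -ξ_k agree and add up to twice a term of the η_q
series. For m = -(2n+1) the pole at 0 adds a Taylor coefficient, which gives η_q(2n); for m = 2j+1 >
0 there is no pole at 0, which gives η_q(-2j-2) = 0. The integrals tend to 0 because Sin_q beats
every power of the radius on these circles. Off the real axis one of E_q(iz), E_q(-iz) dominates the
other, with a quantitative gain (`le_norm_qSin`). Near the real axis, Sin_q x = |E_q(ix)| sin θ(x)
with θ an increasing bijection of the line, and the circles cross the axis where cos θ = 0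
(`exists_le_norm_qSin_of_cos_eq_zero`). The off-axis bound also shows that all zeros are real and,
in the limit at a zero, that Sin_q'(ξ_k) is nonzero and outgrows every power of ξ_k
(`le_norm_deriv_qSin`); hence simplicity, and absolute convergence for every s. -/

/-! ### The product E_q and its functional equation -/

/-- The coefficients of the product `E_q(z) = ∏ (1 + (1 - q) q ^ k z)`. -/
def coeff (q : ℝ) (k : ℕ) : ℝ := (1 - q) * q ^ k

lemma coeff_pos {q : ℝ} (hq0 : 0 < q) (hq1 : q < 1) (k : ℕ) : 0 < coeff q k :=
  mul_pos (by linarith) (pow_pos hq0 k)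

lemma hasSum_coeff {q : ℝ} (hq0 : 0 < q) (hq1 : q < 1) : HasSum (coeff q) 1 := by
  have h := (hasSum_geometric_of_lt_one hq0.le hq1).mul_left (1 - q)
  rwa [mul_inv_cancel₀ (by linarith)] at h

lemma norm_coeff_mul {q : ℝ} (hq0 : 0 < q) (hq1 : q < 1) (k : ℕ) (z : ℂ) :
    ‖(coeff q k : ℂ) * z‖ = coeff q k * ‖z‖ := by
  rw [norm_mul, Complex.norm_real, Real.norm_of_nonneg (coeff_pos hq0 hq1 k).le]

lemma hasSum_norm_coeff_mul {q : ℝ} (hq0 : 0 < q) (hq1 : q < 1) (z : ℂ) :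
    HasSum (fun k => ‖(coeff q k : ℂ) * z‖) ‖z‖ := by
  simp_rw [norm_coeff_mul hq0 hq1]
  simpa using (hasSum_coeff hq0 hq1).mul_right ‖z‖

lemma qExpE_eq_tprod (q : ℝ) (z : ℂ) : qExpE q z = ∏' k, (1 + (coeff q k : ℂ) * z) := by
  unfold qExpE qPochInf coeff
  congr 1
  ext k
  push_cast
  ring

lemma hasProd_qExpE {q : ℝ} (hq0 : 0 < q) (hq1 : q < 1) (z : ℂ) :
    HasProd (fun k => 1 + (coeff q k : ℂ) * z) (qExpE q z) := by
  rw [qExpE_eq_tprod]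
  exact (multipliable_one_add_of_summable (hasSum_norm_coeff_mul hq0 hq1 z).summable).hasProd

lemma differentiable_qExpE {q : ℝ} (hq0 : 0 < q) (hq1 : q < 1) :
    Differentiable ℂ (qExpE q) := by
  intro z
  have h := Summable.hasProdLocallyUniformlyOn_nat_one_add (K := Metric.ball (0 : ℂ) (‖z‖ + 1))
    (f := fun k z => (coeff q k : ℂ) * z) Metric.isOpen_ball
    ((hasSum_coeff hq0 hq1).summable.mul_right (‖z‖ + 1))
    (Eventually.of_forall fun k x hx => by
      rw [norm_coeff_mul hq0 hq1]
      exact mul_le_mul_of_nonneg_left (mem_ball_zero_iff.1 hx).le (coeff_pos hq0 hq1 k).le)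
    (fun k => by fun_prop)
  have h2 := TendstoLocallyUniformlyOn.differentiableOn h
    (Eventually.of_forall fun s => by
      apply Differentiable.differentiableOn
      fun_prop) Metric.isOpen_ball
  have h3 : qExpE q = fun x => ∏' k, (1 + (coeff q k : ℂ) * x) := funext (qExpE_eq_tprod q)
  rw [h3]
  exact h2.differentiableAt (Metric.isOpen_ball.mem_nhds (by simp))

lemma qExpE_zero (q : ℝ) : qExpE q 0 = 1 := by simp [qExpE_eq_tprod]

lemma qExpE_eq_mul {q : ℝ} (hq0 : 0 < q) (hq1 : q < 1) (z : ℂ) :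
    qExpE q z = (1 + (1 - q) * z) * qExpE q (q * z) := by
  have h1 := (hasProd_qExpE hq0 hq1 z).tendsto_prod_nat.comp (tendsto_add_atTop_nat 1)
  have h2 := ((hasProd_qExpE hq0 hq1 (q * z)).tendsto_prod_nat).const_mul (1 + (1 - q) * z)
  refine tendsto_nhds_unique h1 (h2.congr fun n => ?_)
  simp only [Function.comp_apply]
  rw [Finset.prod_range_succ', mul_comm]
  congr 1
  · refine Finset.prod_congr rfl fun k _ => ?_
    simp only [coeff]
    push_cast
    ring
  · simp [coeff]

/-- Differentiating the functional equation at 0 gives E' = (1 - q) + q E'. -/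
lemma deriv_qExpE_zero {q : ℝ} (hq0 : 0 < q) (hq1 : q < 1) : deriv (qExpE q) 0 = 1 := by
  have hd := (differentiable_qExpE hq0 hq1 0).hasDerivAt
  have h1 : HasDerivAt (fun z : ℂ => (1 + (1 - q) * z) * qExpE q (q * z))
      ((1 - q) * qExpE q (q * 0) + (1 + (1 - q) * 0) * (deriv (qExpE q) 0 * q)) 0 := by
    have ha : HasDerivAt (fun z : ℂ => 1 + (1 - (q : ℂ)) * z) (1 - q) 0 := by
      simpa using ((hasDerivAt_id (0 : ℂ)).const_mul (1 - (q : ℂ))).const_add 1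
    have hb : HasDerivAt (fun z : ℂ => (q : ℂ) * z) q 0 := by
      simpa using (hasDerivAt_id (0 : ℂ)).const_mul (q : ℂ)
    have hc : HasDerivAt (fun z : ℂ => qExpE q (q * z)) (deriv (qExpE q) 0 * q) 0 :=
      HasDerivAt.comp (h₂ := qExpE q) 0 (by simpa using hd) hb
    exact ha.mul hc
  have h2 := hd.unique (h1.congr_of_eventuallyEq
    (Eventually.of_forall fun z => qExpE_eq_mul hq0 hq1 z))
  simp only [mul_zero, qExpE_zero, mul_one, add_zero, one_mul] at h2
  have h3 : (1 - (q : ℂ)) ≠ 0 := by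
    rw [sub_ne_zero]; exact_mod_cast hq1.ne'
  exact mul_left_cancel₀ h3 (by linear_combination h2)

/-! ### Growth of E_q in the right half plane -/

lemma normSq_one_add_mul (a : ℝ) (z : ℂ) :
    ‖1 + (a : ℂ) * z‖ ^ 2 = 1 + 2 * a * z.re + a ^ 2 * ‖z‖ ^ 2 := by
  simp only [← Complex.normSq_eq_norm_sq, Complex.normSq_apply, Complex.add_re, Complex.add_im,
    Complex.mul_re, Complex.mul_im, Complex.one_re, Complex.one_im, Complex.ofReal_re,
    Complex.ofReal_im]
  ring

lemma one_le_norm_one_add_mul {a : ℝ} (ha : 0 ≤ a) {z : ℂ} (hz : 0 ≤ z.re) :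
    1 ≤ ‖1 + (a : ℂ) * z‖ := by
  have h := normSq_one_add_mul a z
  have : 0 ≤ a * z.re := mul_nonneg ha hz
  nlinarith [norm_nonneg (1 + (a : ℂ) * z), sq_nonneg (a * ‖z‖)]

lemma mul_norm_le_norm_one_add_mul {a : ℝ} (ha : 0 ≤ a) {z : ℂ} (hz : 0 ≤ z.re) :
    a * ‖z‖ ≤ ‖1 + (a : ℂ) * z‖ := by
  have h := normSq_one_add_mul a z
  have h1 : 0 ≤ a * z.re := mul_nonneg ha hz
  exact abs_le_of_sq_le_sq' (by nlinarith) (norm_nonneg _) |>.2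

/-- With t the subtracted fraction and D its denominator, |1 - az|² = |1 + az|² - 2tD, and |1 + az|²
≤ D bounds this by |1 + az|² (1 - 2t) ≤ |1 + az|² (1 - t)². -/
lemma norm_one_sub_mul_le {a : ℝ} (ha : 0 ≤ a) {z : ℂ} (hz : 0 ≤ z.re) :
    ‖1 - (a : ℂ) * z‖ ≤ ‖1 + (a : ℂ) * z‖ * (1 - 2 * a * z.re / (1 + a * ‖z‖) ^ 2) := by
  have h := normSq_one_add_mul a z
  have h' := normSq_one_add_mul a (-z)
  rw [norm_neg, Complex.neg_re, mul_neg, ← sub_eq_add_neg] at h'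
  have h1 : 0 ≤ a * z.re := mul_nonneg ha hz
  have hre : z.re ≤ ‖z‖ := Complex.re_le_norm z
  have hn : 0 ≤ a * ‖z‖ := mul_nonneg ha (norm_nonneg z)
  set r := ‖z‖
  set D := (1 + a * r) ^ 2 with hD
  have hDpos : 0 < D := by positivity
  have har : a * z.re ≤ a * r := mul_le_mul_of_nonneg_left hre ha
  set t := 2 * a * z.re / D with ht
  have htD : t * D = 2 * a * z.re := by rw [ht]; field_simp
  have ht0 : 0 ≤ t := by positivity
  have ht1 : t ≤ 1 := by rw [ht, div_le_one hDpos]; nlinarith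
  have hND : ‖1 + (a : ℂ) * z‖ ^ 2 ≤ D := by rw [h]; nlinarith
  refine abs_le_of_sq_le_sq' ?_ (mul_nonneg (norm_nonneg _) (by linarith)) |>.2
  have e : ‖1 - (a : ℂ) * z‖ ^ 2 = ‖1 + (a : ℂ) * z‖ ^ 2 - 2 * (t * D) := by
    rw [htD, h, h']; ring
  rw [e]
  nlinarith [mul_nonneg ht0 (sub_nonneg.2 hND), mul_nonneg (sq_nonneg t) (sq_nonneg ‖1 + (a : ℂ) * z‖)]

/-- In the right half plane `E_q` grows faster than every power. -/
lemma prod_coeff_mul_norm_pow_le {q : ℝ} (hq0 : 0 < q) (hq1 : q < 1) (N : ℕ) {z : ℂ}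
    (hz : 0 ≤ z.re) :
    (∏ k ∈ Finset.range N, coeff q k) * ‖z‖ ^ N ≤ ‖qExpE q z‖ := by
  refine ge_of_tendsto (hasProd_qExpE hq0 hq1 z).tendsto_prod_nat.norm ?_
  filter_upwards [eventually_ge_atTop N] with M hM
  rw [norm_prod, ← Finset.prod_range_mul_prod_Ico _ hM]
  have h1 : (∏ k ∈ Finset.range N, coeff q k) * ‖z‖ ^ N
      ≤ ∏ k ∈ Finset.range N, ‖1 + (coeff q k : ℂ) * z‖ := by
    rw [← Finset.card_range N, ← Finset.prod_const, Finset.card_range, ← Finset.prod_mul_distrib]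
    exact Finset.prod_le_prod
      (fun k _ => mul_nonneg (coeff_pos hq0 hq1 k).le (norm_nonneg _))
      (fun k _ => mul_norm_le_norm_one_add_mul (coeff_pos hq0 hq1 k).le hz)
  have h2 : 1 ≤ ∏ k ∈ Finset.Ico N M, ‖1 + (coeff q k : ℂ) * z‖ :=
    Finset.one_le_prod fun k _ => one_le_norm_one_add_mul (coeff_pos hq0 hq1 k).le hz
  exact h1.trans (le_mul_of_one_le_right (Finset.prod_nonneg fun _ _ => norm_nonneg _) h2)

lemma norm_qExpE_neg_le {q : ℝ} (hq0 : 0 < q) (hq1 : q < 1) {z : ℂ} (hz : 0 ≤ z.re) :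
    ‖qExpE q (-z)‖ ≤ ‖qExpE q z‖ := by
  refine le_of_tendsto_of_tendsto' (hasProd_qExpE hq0 hq1 (-z)).tendsto_prod_nat.norm
    (hasProd_qExpE hq0 hq1 z).tendsto_prod_nat.norm fun M => ?_
  rw [norm_prod, norm_prod]
  refine Finset.prod_le_prod (fun _ _ => norm_nonneg _) fun k _ => ?_
  have ha := (coeff_pos hq0 hq1 k).le
  rw [mul_neg, ← sub_eq_add_neg]
  refine (norm_one_sub_mul_le ha hz).trans (mul_le_of_le_one_right (norm_nonneg _) ?_)
  have : 0 ≤ 2 * coeff q k * z.re / (1 + coeff q k * ‖z‖) ^ 2 := by positivity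
  linarith

/-- The gain comes from the factor k = 0 alone, split off by the functional equation; the other
factors only need the plain comparison. -/
lemma norm_qExpE_neg_le_mul {q : ℝ} (hq0 : 0 < q) (hq1 : q < 1) {z : ℂ} (hz : 0 ≤ z.re) :
    ‖qExpE q (-z)‖ ≤
      ‖qExpE q z‖ * (1 - 2 * (1 - q) * z.re / (1 + (1 - q) * ‖z‖) ^ 2) := by
  have hp : 0 ≤ 1 - q := by linarith
  have h0 := norm_one_sub_mul_le hp hz
  have h1 : ‖qExpE q (-(q * z))‖ ≤ ‖qExpE q (q * z)‖ :=
    norm_qExpE_neg_le hq0 hq1 (by simpa using mul_nonneg hq0.le hz)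
  rw [qExpE_eq_mul hq0 hq1 z, qExpE_eq_mul hq0 hq1 (-z), norm_mul, norm_mul, mul_neg, mul_neg,
    ← sub_eq_add_neg]
  push_cast at h0
  calc _ ≤ ‖1 + (1 - (q : ℂ)) * z‖ * (1 - 2 * (1 - q) * z.re / (1 + (1 - q) * ‖z‖) ^ 2) *
        ‖qExpE q (q * z)‖ :=
        mul_le_mul h0 h1 (norm_nonneg _) ((norm_nonneg _).trans h0)
    _ = _ := by ring

/-! ### Sin_q and its lower bounds off the real axis -/

lemma qSin_neg (q : ℝ) (z : ℂ) : qSin q (-z) = -qSin q z := by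
  unfold qSin
  rw [mul_neg, neg_neg]
  ring

lemma qSin_zero (q : ℝ) : qSin q 0 = 0 := by simp [qSin]

lemma differentiable_qSin {q : ℝ} (hq0 : 0 < q) (hq1 : q < 1) : Differentiable ℂ (qSin q) := by
  have h := differentiable_qExpE hq0 hq1
  unfold qSin
  exact ((h.comp (by fun_prop : Differentiable ℂ fun z : ℂ => Complex.I * z)).sub
    (h.comp (by fun_prop : Differentiable ℂ fun z : ℂ => -(Complex.I * z)))).div_const _

lemma deriv_qSin_neg (q : ℝ) (z : ℂ) : deriv (qSin q) (-z) = deriv (qSin q) z := by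
  have h1 : deriv (fun x => qSin q (-x)) z = -deriv (qSin q) (-z) := deriv_comp_neg _ _
  have h2 : (fun x => qSin q (-x)) = fun x => -qSin q x := funext (qSin_neg q)
  rw [h2, deriv.fun_neg] at h1
  exact (neg_injective h1).symm

lemma deriv_qSin_zero {q : ℝ} (hq0 : 0 < q) (hq1 : q < 1) : deriv (qSin q) 0 = 1 := by
  have hd := (differentiable_qExpE hq0 hq1 0).hasDerivAt
  rw [deriv_qExpE_zero hq0 hq1] at hd
  have ha : HasDerivAt (fun z : ℂ => Complex.I * z) Complex.I 0 := by
    simpa using (hasDerivAt_id (0 : ℂ)).const_mul Complex.I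
  have h1 : HasDerivAt (fun z : ℂ => qExpE q (Complex.I * z)) (1 * Complex.I) 0 :=
    HasDerivAt.comp (h₂ := qExpE q) 0 (by simpa using hd) ha
  have h2 : HasDerivAt (fun z : ℂ => qExpE q (-(Complex.I * z))) (1 * -Complex.I) 0 :=
    HasDerivAt.comp (h₂ := qExpE q) 0 (by simpa using hd) ha.neg
  have h3 : HasDerivAt (qSin q) ((1 * Complex.I - 1 * -Complex.I) / (2 * Complex.I)) 0 :=
    (h1.sub h2).div_const _
  rw [h3.deriv]
  field_simp
  ring

/-- The constant in the polynomial lower bounds for `Sin_q`. -/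
def growthConst (q : ℝ) (N : ℕ) : ℝ := (1 - q) * ∏ k ∈ Finset.range N, coeff q k

lemma growthConst_pos {q : ℝ} (hq0 : 0 < q) (hq1 : q < 1) (N : ℕ) : 0 < growthConst q N :=
  mul_pos (by linarith) (Finset.prod_pos fun k _ => coeff_pos hq0 hq1 k)

/-- For Im z ≥ 0 the term E_q(-iz) dominates E_q(iz), and the relative gap is at least of order Im z
/ (1 + |z|)². -/
lemma le_norm_qSin {q : ℝ} (hq0 : 0 < q) (hq1 : q < 1) (N : ℕ) (z : ℂ) :
    growthConst q N * ‖z‖ ^ N * |z.im| ≤ ‖qSin q z‖ * (1 + ‖z‖) ^ 2 := by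
  wlog hz : 0 ≤ z.im generalizing z
  · have := this (-z) (by simp only [Complex.neg_im]; linarith)
    simpa [qSin_neg] using this
  have hp : 0 ≤ 1 - q := by linarith
  set w : ℂ := -(Complex.I * z) with hw
  have hwre : w.re = z.im := by simp [hw]
  have hwn : ‖w‖ = ‖z‖ := by simp [hw]
  have h1 := norm_qExpE_neg_le_mul hq0 hq1 (z := w) (by rw [hwre]; exact hz)
  have h2 := prod_coeff_mul_norm_pow_le hq0 hq1 N (z := w) (by rw [hwre]; exact hz)
  rw [hwre, hwn] at h1
  rw [hwn] at h2
  have h3 : 2 * ‖qSin q z‖ = ‖qExpE q (-w) - qExpE q w‖ := by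
    rw [hw, neg_neg, qSin, norm_div, norm_mul, Complex.norm_I, Complex.norm_ofNat]
    ring
  have h4 : ‖qExpE q w‖ - ‖qExpE q (-w)‖ ≤ ‖qExpE q (-w) - qExpE q w‖ := by
    rw [norm_sub_rev]; exact norm_sub_norm_le _ _
  rw [abs_of_nonneg hz]
  set D := (1 + (1 - q) * ‖z‖) ^ 2 with hD
  have hDpos : 0 < D := by positivity
  have hDle : D ≤ (1 + ‖z‖) ^ 2 := by
    rw [hD]
    gcongr
    nlinarith [norm_nonneg z]
  have h5 : ‖qExpE q w‖ * ((1 - q) * z.im / D) ≤ ‖qSin q z‖ := by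
    have : 2 * (1 - q) * z.im / D = 2 * ((1 - q) * z.im / D) := by ring
    rw [this] at h1
    linarith
  have h6 : ‖qExpE q w‖ * ((1 - q) * z.im) ≤ ‖qSin q z‖ * D := by
    rwa [← mul_div_assoc, div_le_iff₀ hDpos] at h5
  calc growthConst q N * ‖z‖ ^ N * z.im
      = ((∏ k ∈ Finset.range N, coeff q k) * ‖z‖ ^ N) * ((1 - q) * z.im) := by
        rw [growthConst]; ring
    _ ≤ ‖qExpE q w‖ * ((1 - q) * z.im) := by gcongr
    _ ≤ ‖qSin q z‖ * D := h6
    _ ≤ _ := by gcongr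

lemma im_eq_zero_of_qSin_eq_zero {q : ℝ} (hq0 : 0 < q) (hq1 : q < 1) {z : ℂ}
    (hz : qSin q z = 0) : z.im = 0 := by
  have h := le_norm_qSin hq0 hq1 0 z
  rw [hz, norm_zero, zero_mul, pow_zero, mul_one] at h
  have := growthConst_pos hq0 hq1 0
  have h2 : |z.im| ≤ 0 := by
    by_contra! hc
    nlinarith
  exact abs_nonpos_iff.1 h2

lemma le_norm_deriv_qSin {q : ℝ} (hq0 : 0 < q) (hq1 : q < 1) (N : ℕ) {x : ℝ}
    (hx : qSin q x = 0) :
    growthConst q N * |x| ^ N ≤ ‖deriv (qSin q) x‖ * (1 + |x|) ^ 2 := by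
  have hd := (differentiable_qSin hq0 hq1 x).hasDerivAt
  -- Approach x vertically: the imaginary part in the lower bound for Sin_q then cancels the
  -- denominator of the difference quotient.
  have hpath : Tendsto (fun y : ℝ => (x : ℂ) + y * Complex.I) (𝓝[≠] 0) (𝓝[≠] (x : ℂ)) := by
    rw [tendsto_nhdsWithin_iff]
    constructor
    · refine Tendsto.mono_left ?_ nhdsWithin_le_nhds
      have : Continuous fun y : ℝ => (x : ℂ) + y * Complex.I := by fun_prop
      simpa using this.tendsto 0
    · filter_upwards [self_mem_nhdsWithin] with y hy
      simpa using hy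
  have h1 := (hd.tendsto_slope.comp hpath).norm
  have h2 : Tendsto (fun y : ℝ => ‖(x : ℂ) + y * Complex.I‖) (𝓝[≠] 0) (𝓝 |x|) := by
    refine Tendsto.mono_left ?_ nhdsWithin_le_nhds
    have : Continuous fun y : ℝ => ‖(x : ℂ) + y * Complex.I‖ := by fun_prop
    simpa using this.tendsto 0
  refine le_of_tendsto_of_tendsto ((h2.pow N).const_mul (growthConst q N))
    (h1.mul ((h2.const_add 1).pow 2)) ?_
  filter_upwards [self_mem_nhdsWithin] with y hy
  have h3 := le_norm_qSin hq0 hq1 N ((x : ℂ) + y * Complex.I)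
  have hy' : 0 < |y| := abs_pos.2 hy
  simp only [Function.comp_apply, slope_def_field, hx, sub_zero, add_sub_cancel_left, norm_div,
    norm_mul, Complex.norm_I, mul_one, Complex.norm_real, Real.norm_eq_abs]
  have him : ((x : ℂ) + y * Complex.I).im = y := by simp
  rw [him] at h3
  rw [div_mul_eq_mul_div, le_div_iff₀ hy']
  exact h3


/-! ### The phase θ and its inverse -/

lemma arctan_sub_arctan_le {x y : ℝ} (hxy : x ≤ y) :
    Real.arctan y - Real.arctan x ≤ y - x := by
  have := image_sub_le_mul_sub_of_deriv_le Real.differentiable_arctan (C := 1) (fun x => by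
    rw [Real.deriv_arctan]
    exact (div_le_one (by positivity)).2 (by nlinarith [sq_nonneg x])) hxy
  linarith

lemma abs_arctan_le (x : ℝ) : |Real.arctan x| ≤ |x| := by
  rcases le_total 0 x with h | h
  · have h1 := arctan_sub_arctan_le h
    rw [abs_of_nonneg (Real.arctan_nonneg.2 h), abs_of_nonneg h]
    simpa using h1
  · have h1 := arctan_sub_arctan_le h
    rw [abs_of_nonpos (Real.arctan_le_zero.2 h), abs_of_nonpos h]
    simpa using h1

/-- The argument of `E_q(ix)`, as a continuous function of the real variable `x`. -/
noncomputable def theta (q x : ℝ) : ℝ := ∑' k, Real.arctan (coeff q k * x)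

lemma hasSum_theta {q : ℝ} (hq0 : 0 < q) (hq1 : q < 1) (x : ℝ) :
    HasSum (fun k => Real.arctan (coeff q k * x)) (theta q x) := by
  refine Summable.hasSum (Summable.of_norm_bounded
    ((hasSum_coeff hq0 hq1).summable.mul_right |x|) fun k => ?_)
  refine (abs_arctan_le _).trans_eq ?_
  rw [abs_mul, abs_of_pos (coeff_pos hq0 hq1 k)]

lemma theta_zero (q : ℝ) : theta q 0 = 0 := by simp [theta]

lemma theta_neg (q x : ℝ) : theta q (-x) = -theta q x := by
  simp [theta, Real.arctan_neg, tsum_neg]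

lemma theta_strictMono {q : ℝ} (hq0 : 0 < q) (hq1 : q < 1) : StrictMono (theta q) := by
  intro x y hxy
  have h : ∀ k, Real.arctan (coeff q k * x) < Real.arctan (coeff q k * y) := fun k =>
    Real.arctan_strictMono (mul_lt_mul_of_pos_left hxy (coeff_pos hq0 hq1 k))
  exact hasSum_lt (fun k => (h k).le) (h 0) (hasSum_theta hq0 hq1 x) (hasSum_theta hq0 hq1 y)

lemma theta_sub_le {q : ℝ} (hq0 : 0 < q) (hq1 : q < 1) {x y : ℝ} (hxy : x ≤ y) :
    theta q y - theta q x ≤ y - x := by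
  have h1 := (hasSum_theta hq0 hq1 y).sub (hasSum_theta hq0 hq1 x)
  have h2 := (hasSum_coeff hq0 hq1).mul_right (y - x)
  rw [one_mul] at h2
  refine hasSum_le (fun k => ?_) h1 h2
  rw [mul_sub]
  exact arctan_sub_arctan_le (mul_le_mul_of_nonneg_left hxy (coeff_pos hq0 hq1 k).le)

lemma continuous_theta {q : ℝ} (hq0 : 0 < q) (hq1 : q < 1) : Continuous (theta q) := by
  have h : LipschitzWith 1 (theta q) := LipschitzWith.of_le_add fun x y => by
    rcases le_total x y with h | h
    · exact ((theta_strictMono hq0 hq1).monotone h).trans (le_add_of_nonneg_right dist_nonneg)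
    · have := theta_sub_le hq0 hq1 h
      rw [Real.dist_eq, abs_of_nonneg (by linarith)]
      linarith
  exact h.continuous

lemma tendsto_theta_atTop {q : ℝ} (hq0 : 0 < q) (hq1 : q < 1) :
    Tendsto (theta q) atTop atTop := by
  refine (theta_strictMono hq0 hq1).monotone.tendsto_atTop_atTop fun b => ?_
  obtain ⟨N, hN⟩ := exists_nat_ge (b / (Real.pi / 4))
  rw [div_le_iff₀ (by positivity)] at hN
  -- At this point each of the first N arctangents has argument at least 1, so it is at least π/4.
  refine ⟨1 / coeff q N, hN.trans ?_⟩
  have hcN := coeff_pos hq0 hq1 N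
  have h1 : ∑ k ∈ Finset.range N, Real.arctan (coeff q k * (1 / coeff q N)) ≤
      theta q (1 / coeff q N) :=
    sum_le_hasSum _ (fun k _ => Real.arctan_nonneg.2
      (mul_nonneg (coeff_pos hq0 hq1 k).le (by positivity))) (hasSum_theta hq0 hq1 _)
  refine le_trans ?_ h1
  have h2 := Finset.card_nsmul_le_sum (Finset.range N)
    (fun k => Real.arctan (coeff q k * (1 / coeff q N))) (Real.pi / 4) fun k hk => by
      rw [← Real.arctan_one]
      apply Real.arctan_mono
      rw [mul_one_div, le_div_iff₀ hcN, one_mul]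
      exact mul_le_mul_of_nonneg_left
        (pow_le_pow_of_le_one hq0.le hq1.le (Finset.mem_range.1 hk).le) (by linarith)
  simpa using h2

lemma theta_surjective {q : ℝ} (hq0 : 0 < q) (hq1 : q < 1) : Function.Surjective (theta q) := by
  have h := tendsto_theta_atTop hq0 hq1
  refine (continuous_theta hq0 hq1).surjective h ?_
  have h2 : theta q = fun x => -theta q (-x) := by ext x; rw [theta_neg, neg_neg]
  rw [h2]
  exact tendsto_neg_atTop_atBot.comp (h.comp tendsto_neg_atBot_atTop)

/-- The inverse function of `theta`. -/
noncomputable def thetaInv (q c : ℝ) : ℝ := Function.invFun (theta q) c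

lemma theta_thetaInv {q : ℝ} (hq0 : 0 < q) (hq1 : q < 1) (c : ℝ) :
    theta q (thetaInv q c) = c :=
  Function.rightInverse_invFun (theta_surjective hq0 hq1) c

lemma thetaInv_theta {q : ℝ} (hq0 : 0 < q) (hq1 : q < 1) (x : ℝ) :
    thetaInv q (theta q x) = x :=
  Function.leftInverse_invFun (theta_strictMono hq0 hq1).injective x

lemma thetaInv_strictMono {q : ℝ} (hq0 : 0 < q) (hq1 : q < 1) : StrictMono (thetaInv q) := by
  intro a b hab
  rw [← (theta_strictMono hq0 hq1).lt_iff_lt, theta_thetaInv hq0 hq1, theta_thetaInv hq0 hq1]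
  exact hab

lemma thetaInv_zero {q : ℝ} (hq0 : 0 < q) (hq1 : q < 1) : thetaInv q 0 = 0 := by
  simpa [theta_zero] using thetaInv_theta hq0 hq1 0

lemma le_thetaInv {q : ℝ} (hq0 : 0 < q) (hq1 : q < 1) {c : ℝ} (hc : 0 ≤ c) :
    c ≤ thetaInv q c := by
  have h0 : 0 ≤ thetaInv q c := by
    rw [← thetaInv_zero hq0 hq1]
    exact (thetaInv_strictMono hq0 hq1).monotone hc
  have := theta_sub_le hq0 hq1 h0
  rwa [theta_zero, theta_thetaInv hq0 hq1, sub_zero, sub_zero] at this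

/-! ### Polar form on the imaginary axis and the real zeros of Sin_q -/

lemma one_add_mul_I_eq (u : ℝ) :
    1 + (u : ℂ) * Complex.I =
      ‖1 + (u : ℂ) * Complex.I‖ * Complex.exp (Real.arctan u * Complex.I) := by
  have h : Complex.arg (1 + (u : ℂ) * Complex.I) = Real.arctan u := by
    rw [Complex.arg_of_re_nonneg (by simp), Real.arctan_eq_arcsin]
    congr 1
    have h1 : ‖1 + (u : ℂ) * Complex.I‖ = √(1 + u ^ 2) := by
      rw [← Real.sqrt_sq (norm_nonneg _), normSq_one_add_mul]
      simp
    rw [h1]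
    simp
  conv_lhs => rw [← Complex.norm_mul_exp_arg_mul_I (1 + (u : ℂ) * Complex.I), h]

lemma qExpE_I_mul {q : ℝ} (hq0 : 0 < q) (hq1 : q < 1) (x : ℝ) :
    qExpE q (Complex.I * x) =
      ‖qExpE q (Complex.I * x)‖ * Complex.exp (theta q x * Complex.I) := by
  have h := (hasProd_qExpE hq0 hq1 (Complex.I * x)).tendsto_prod_nat
  have h2 := (Complex.continuous_ofReal.tendsto _).comp h.norm
  have h3 := (((Complex.continuous_ofReal.tendsto _).comp
    (hasSum_theta hq0 hq1 x).tendsto_sum_nat).mul_const Complex.I).cexp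
  refine tendsto_nhds_unique h ((h2.mul h3).congr fun n => ?_)
  simp only [Function.comp_apply]
  rw [norm_prod, Complex.ofReal_prod, Complex.ofReal_sum, Finset.sum_mul, Complex.exp_sum,
    ← Finset.prod_mul_distrib]
  refine Finset.prod_congr rfl fun k _ => ?_
  have := one_add_mul_I_eq (coeff q k * x)
  rw [show (coeff q k : ℂ) * (Complex.I * x) = ((coeff q k * x : ℝ) : ℂ) * Complex.I by
    push_cast; ring, ← this]

/-- Both ix and -ix lie in the closed right half plane, so the comparison applies in both
directions. -/
lemma norm_qExpE_neg_I_mul {q : ℝ} (hq0 : 0 < q) (hq1 : q < 1) (x : ℝ) :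
    ‖qExpE q (-(Complex.I * x))‖ = ‖qExpE q (Complex.I * x)‖ := by
  refine le_antisymm (norm_qExpE_neg_le hq0 hq1 (by simp)) ?_
  simpa using norm_qExpE_neg_le hq0 hq1 (z := -(Complex.I * x)) (by simp)

lemma qExpE_neg_I_mul {q : ℝ} (hq0 : 0 < q) (hq1 : q < 1) (x : ℝ) :
    qExpE q (-(Complex.I * x)) =
      ‖qExpE q (Complex.I * x)‖ * Complex.exp (-theta q x * Complex.I) := by
  have h := qExpE_I_mul hq0 hq1 (-x)
  rw [theta_neg] at h
  push_cast at h
  rwa [mul_neg, norm_qExpE_neg_I_mul hq0 hq1] at h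

lemma qSin_ofReal {q : ℝ} (hq0 : 0 < q) (hq1 : q < 1) (x : ℝ) :
    qSin q x = ‖qExpE q (Complex.I * x)‖ * Real.sin (theta q x) := by
  rw [qSin, qExpE_neg_I_mul hq0 hq1, qExpE_I_mul hq0 hq1 x, Complex.ofReal_sin, Complex.sin,
    Complex.norm_mul, Complex.norm_exp_ofReal_mul_I, mul_one, Complex.norm_real, norm_norm]
  field_simp
  rw [Complex.I_sq]
  ring

lemma qExpE_add_qExpE_neg {q : ℝ} (hq0 : 0 < q) (hq1 : q < 1) (x : ℝ) :
    qExpE q (Complex.I * x) + qExpE q (-(Complex.I * x)) =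
      2 * (‖qExpE q (Complex.I * x)‖ * Real.cos (theta q x)) := by
  rw [qExpE_neg_I_mul hq0 hq1, qExpE_I_mul hq0 hq1 x, Complex.ofReal_cos, Complex.cos,
    Complex.norm_mul, Complex.norm_exp_ofReal_mul_I, mul_one, Complex.norm_real, norm_norm]
  ring

lemma qExpE_I_mul_ne_zero {q : ℝ} (hq0 : 0 < q) (hq1 : q < 1) (x : ℝ) :
    qExpE q (Complex.I * x) ≠ 0 := by
  have := prod_coeff_mul_norm_pow_le hq0 hq1 0 (z := Complex.I * x) (by simp)
  intro h
  rw [h] at this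
  norm_num at this

lemma qSin_ofReal_eq_zero_iff {q : ℝ} (hq0 : 0 < q) (hq1 : q < 1) {x : ℝ} :
    qSin q x = 0 ↔ ∃ n : ℤ, x = thetaInv q (n * Real.pi) := by
  rw [qSin_ofReal hq0 hq1, mul_eq_zero, Complex.ofReal_eq_zero, Complex.ofReal_eq_zero,
    or_iff_right (norm_ne_zero_iff.2 (qExpE_I_mul_ne_zero hq0 hq1 x)), Real.sin_eq_zero_iff]
  refine exists_congr fun n => ⟨fun h => ?_, fun h => ?_⟩
  · rw [h, thetaInv_theta hq0 hq1]
  · rw [h, theta_thetaInv hq0 hq1]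

lemma qSinZero_eq {q : ℝ} (hq0 : 0 < q) (hq1 : q < 1) (k : ℕ) :
    qSinZero q k = thetaInv q (k * Real.pi) := by
  induction k with
  | zero => simp [qSinZero, thetaInv_zero hq0 hq1]
  | succ k ih =>
    rw [qSinZero, ih]
    refine IsLeast.csInf_eq ⟨⟨?_, ?_⟩, ?_⟩
    · refine thetaInv_strictMono hq0 hq1 ?_
      push_cast
      nlinarith [Real.pi_pos]
    · exact (qSin_ofReal_eq_zero_iff hq0 hq1).2 ⟨k + 1, by push_cast; rfl⟩
    · rintro x ⟨hx1, hx2⟩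
      obtain ⟨n, rfl⟩ := (qSin_ofReal_eq_zero_iff hq0 hq1).1 hx2
      rw [(thetaInv_strictMono hq0 hq1).lt_iff_lt, mul_lt_mul_iff_left₀ Real.pi_pos] at hx1
      rw [(thetaInv_strictMono hq0 hq1).le_iff_le, mul_le_mul_iff_left₀ Real.pi_pos]
      have h1 : (k : ℤ) < n := by exact_mod_cast hx1
      exact_mod_cast h1

lemma qSinZero_strictMono {q : ℝ} (hq0 : 0 < q) (hq1 : q < 1) : StrictMono (qSinZero q) := by
  intro a b hab
  rw [qSinZero_eq hq0 hq1, qSinZero_eq hq0 hq1]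
  exact thetaInv_strictMono hq0 hq1
    (mul_lt_mul_of_pos_right (by exact_mod_cast hab) Real.pi_pos)

lemma le_qSinZero {q : ℝ} (hq0 : 0 < q) (hq1 : q < 1) (k : ℕ) : (k : ℝ) ≤ qSinZero q k := by
  rw [qSinZero_eq hq0 hq1]
  refine le_trans ?_ (le_thetaInv hq0 hq1 (by positivity))
  nlinarith [Real.pi_gt_three, (Nat.cast_nonneg k : (0 : ℝ) ≤ k)]

lemma qSinZero_succ_pos {q : ℝ} (hq0 : 0 < q) (hq1 : q < 1) (k : ℕ) : 0 < qSinZero q (k + 1) :=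
  lt_of_lt_of_le (by positivity) (le_qSinZero hq0 hq1 (k + 1))

lemma qSin_qSinZero {q : ℝ} (hq0 : 0 < q) (hq1 : q < 1) (k : ℕ) : qSin q (qSinZero q k) = 0 := by
  rw [qSin_ofReal_eq_zero_iff hq0 hq1]
  exact ⟨k, by rw [qSinZero_eq hq0 hq1]; push_cast; rfl⟩

lemma range_qSinZero {q : ℝ} (hq0 : 0 < q) (hq1 : q < 1) :
    Set.range (fun k : ℕ => qSinZero q (k + 1)) = {x : ℝ | 0 < x ∧ qSin q (x : ℂ) = 0} := by
  ext x
  constructor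
  · rintro ⟨k, rfl⟩
    exact ⟨qSinZero_succ_pos hq0 hq1 k, qSin_qSinZero hq0 hq1 _⟩
  · rintro ⟨hx0, hx⟩
    obtain ⟨n, rfl⟩ := (qSin_ofReal_eq_zero_iff hq0 hq1).1 hx
    rw [← thetaInv_zero hq0 hq1, (thetaInv_strictMono hq0 hq1).lt_iff_lt] at hx0
    have hn : 0 < n := by
      have := pos_of_mul_pos_left hx0 Real.pi_pos.le
      exact_mod_cast this
    obtain ⟨m, rfl⟩ := Int.eq_succ_of_zero_lt hn
    exact ⟨m, by simp [qSinZero_eq hq0 hq1]⟩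

lemma deriv_qSin_qSinZero_ne_zero {q : ℝ} (hq0 : 0 < q) (hq1 : q < 1) (k : ℕ) :
    deriv (qSin q) (qSinZero q (k + 1)) ≠ 0 := by
  intro h
  have := le_norm_deriv_qSin hq0 hq1 0 (qSin_qSinZero hq0 hq1 (k + 1))
  rw [h] at this
  have h2 := growthConst_pos hq0 hq1 0
  simp only [pow_zero, norm_zero, zero_mul] at this
  linarith


/-! ### Lower bounds for Sin_q on large circles -/

/-- On the imaginary axis each factor has modulus at least 1, so dividing by it does not enlarge the
perturbation; as the coefficients sum to 1, the relative error is uniform in w. -/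
lemma norm_qExpE_add_sub_le {q : ℝ} (hq0 : 0 < q) (hq1 : q < 1) {w : ℂ} (hw : w.re = 0) (h : ℂ) :
    ‖qExpE q (w + h) - qExpE q w‖ ≤ ‖qExpE q w‖ * (Real.exp ‖h‖ - 1) := by
  have h1 := (hasProd_qExpE hq0 hq1 (w + h)).tendsto_prod_nat
  have h2 := (hasProd_qExpE hq0 hq1 w).tendsto_prod_nat
  refine le_of_tendsto_of_tendsto' (h1.sub h2).norm (h2.norm.mul_const _) fun n => ?_
  have hge : ∀ k, 1 ≤ ‖1 + (coeff q k : ℂ) * w‖ := fun k =>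
    one_le_norm_one_add_mul (coeff_pos hq0 hq1 k).le hw.ge
  have hne : ∀ k, 1 + (coeff q k : ℂ) * w ≠ 0 := fun k hk => by
    have := hge k
    rw [hk, norm_zero] at this
    linarith
  have e : ∏ k ∈ Finset.range n, (1 + (coeff q k : ℂ) * (w + h)) =
      (∏ k ∈ Finset.range n, (1 + (coeff q k : ℂ) * w)) *
        ∏ k ∈ Finset.range n, (1 + (coeff q k : ℂ) * h / (1 + (coeff q k : ℂ) * w)) := by
    rw [← Finset.prod_mul_distrib]
    refine Finset.prod_congr rfl fun k _ => ?_
    have := hne k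
    field_simp
    ring
  rw [e, ← mul_sub_one, norm_mul]
  refine mul_le_mul_of_nonneg_left ?_ (norm_nonneg _)
  refine (Finset.norm_prod_one_add_sub_one_le _ _).trans (sub_le_sub_right (Real.exp_le_exp.2 ?_) 1)
  calc _ ≤ ∑ k ∈ Finset.range n, ‖(coeff q k : ℂ) * h‖ := Finset.sum_le_sum fun k _ => by
        rw [norm_div]
        exact div_le_self (norm_nonneg _) (hge k)
    _ ≤ ‖h‖ := sum_le_hasSum _ (fun _ _ => norm_nonneg _) (hasSum_norm_coeff_mul hq0 hq1 h)

/-- When cos θ = 0, E_q(-ix) = -E_q(ix), so the two terms of Sin_q reinforce each other; moving by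
at most 1/8 changes each by at most a quarter of its modulus. -/
lemma norm_qExpE_le_norm_qSin_add {q : ℝ} (hq0 : 0 < q) (hq1 : q < 1) {x : ℝ}
    (hx : Real.cos (theta q x) = 0) {h : ℂ} (hh : ‖h‖ ≤ 1 / 8) :
    ‖qExpE q (Complex.I * x)‖ ≤ 2 * ‖qSin q (x + h)‖ := by
  have h0 := qExpE_add_qExpE_neg hq0 hq1 x
  rw [hx, Complex.ofReal_zero, mul_zero, mul_zero] at h0
  have hexp : Real.exp ‖h‖ - 1 ≤ 1 / 4 := by
    have h1 := Real.abs_exp_sub_one_le (x := ‖h‖) (by rw [abs_norm]; linarith)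
    rw [abs_norm] at h1
    linarith [le_abs_self (Real.exp ‖h‖ - 1)]
  have h1 := norm_qExpE_add_sub_le hq0 hq1 (w := Complex.I * x) (by simp) (Complex.I * h)
  have h2 := norm_qExpE_add_sub_le hq0 hq1 (w := -(Complex.I * x)) (by simp) (-(Complex.I * h))
  rw [norm_qExpE_neg_I_mul hq0 hq1, norm_neg] at h2
  rw [norm_mul, Complex.norm_I, one_mul] at h1 h2
  set A := qExpE q (Complex.I * x)
  have hA := mul_le_mul_of_nonneg_left hexp (norm_nonneg A)
  set B := qExpE q (Complex.I * x + Complex.I * h) with hB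
  set B' := qExpE q (-(Complex.I * x) + -(Complex.I * h)) with hB'
  have h3 : 2 * ‖qSin q (x + h)‖ = ‖B - B'‖ := by
    rw [hB, hB', ← neg_add, ← mul_add, qSin, norm_div, norm_mul, Complex.norm_I,
      Complex.norm_ofNat]
    ring
  have h4 : 2 * A = (B - B') - (B - A) + (B' - qExpE q (-(Complex.I * x))) := by
    linear_combination h0
  have h5 : 2 * ‖A‖ ≤ ‖B - B'‖ + ‖B - A‖ + ‖B' - qExpE q (-(Complex.I * x))‖ := by
    calc 2 * ‖A‖ = ‖2 * A‖ := by rw [norm_mul, Complex.norm_ofNat]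
      _ ≤ _ := by
        rw [h4]
        exact (norm_add_le _ _).trans (add_le_add_left (norm_sub_le _ _) _)
  rw [h3]
  linarith [norm_nonneg A]

/-- On the circles through the real points where `cos θ = 0`, the function `Sin_q` is bounded
below by every power of the radius. -/
lemma exists_le_norm_qSin_of_cos_eq_zero {q : ℝ} (hq0 : 0 < q) (hq1 : q < 1) (N : ℕ) :
    ∃ C : ℝ, 0 < C ∧ ∀ R : ℝ, 1 ≤ R → Real.cos (theta q R) = 0 → ∀ z : ℂ, ‖z‖ = R →
      C * R ^ N ≤ ‖qSin q z‖ := by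
  have g1 := growthConst_pos hq0 hq1 N
  have g2 := growthConst_pos hq0 hq1 (N + 2)
  -- The first constant serves the arc near the real axis. The second serves |Im z| ≥ 1/16: the two
  -- extra powers absorb (1 + R)² ≤ 4R², and 64 = 16 · 4.
  refine ⟨min (growthConst q N / 2) (growthConst q (N + 2) / 64), by positivity,
    fun R hR hcos z hz => ?_⟩
  wlog hre : 0 ≤ z.re generalizing z
  · have := this (-z) (by rwa [norm_neg]) (by simp only [Complex.neg_re]; linarith)
    rwa [qSin_neg, norm_neg] at this
  have hR0 : 0 < R := by linarith
  have hsq : z.re ^ 2 + z.im ^ 2 = R ^ 2 := by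
    rw [← hz, ← Complex.normSq_eq_norm_sq, Complex.normSq_apply]; ring
  rcases le_total |z.im| (1 / 16) with him | him
  · have hnear : ‖z - R‖ ≤ 1 / 8 := by
      refine abs_le_of_sq_le_sq' ?_ (by norm_num) |>.2
      rw [← Complex.normSq_eq_norm_sq, Complex.normSq_apply]
      simp only [Complex.sub_re, Complex.sub_im, Complex.ofReal_re, Complex.ofReal_im, sub_zero]
      have h1 : z.im ^ 2 ≤ (1 / 16) ^ 2 := by
        rw [← sq_abs]; gcongr
      have h2 : z.re ≤ R := hz ▸ Complex.re_le_norm z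
      have h3 : R * (R - z.re) ≤ z.im ^ 2 := by nlinarith
      nlinarith
    have h1 := norm_qExpE_le_norm_qSin_add hq0 hq1 hcos hnear
    rw [add_sub_cancel] at h1
    have h2 := prod_coeff_mul_norm_pow_le hq0 hq1 N (z := Complex.I * R) (by simp)
    rw [norm_mul, Complex.norm_I, one_mul, Complex.norm_real, Real.norm_of_nonneg hR0.le] at h2
    have h3 : growthConst q N ≤ ∏ k ∈ Finset.range N, coeff q k :=
      mul_le_of_le_one_left (Finset.prod_nonneg fun k _ => (coeff_pos hq0 hq1 k).le) (by linarith)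
    calc _ ≤ growthConst q N / 2 * R ^ N := by gcongr; exact min_le_left _ _
      _ = growthConst q N * R ^ N / 2 := by ring
      _ ≤ (∏ k ∈ Finset.range N, coeff q k) * R ^ N / 2 := by gcongr
      _ ≤ ‖qSin q z‖ := by linarith
  · have h1 := le_norm_qSin hq0 hq1 (N + 2) z
    rw [hz] at h1
    have h2 : growthConst q (N + 2) * R ^ (N + 2) * (1 / 16) ≤ ‖qSin q z‖ * (1 + R) ^ 2 :=
      (mul_le_mul_of_nonneg_left him (by positivity)).trans h1
    have h3 : ‖qSin q z‖ * (1 + R) ^ 2 ≤ ‖qSin q z‖ * (2 * R) ^ 2 := by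
      gcongr
      linarith
    have h4 : growthConst q (N + 2) / 64 * R ^ N * R ^ 2 ≤ ‖qSin q z‖ * R ^ 2 := by
      rw [pow_add] at h2
      linarith
    calc _ ≤ growthConst q (N + 2) / 64 * R ^ N := by gcongr; exact min_le_right _ _
      _ ≤ _ := le_of_mul_le_mul_right h4 (by positivity)


/-! ### Residue calculus for reciprocals of functions with simple zeros -/

lemma analyticAt_dslope {f : ℂ → ℂ} {a : ℂ} (hf : AnalyticAt ℂ f a) :
    AnalyticAt ℂ (dslope f a) a := by
  obtain ⟨p, hp⟩ := hf
  exact hp.has_fpower_series_dslope_fslope.analyticAt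

lemma analyticAt_inv_sub {ρ z : ℂ} (h : z ≠ ρ) : AnalyticAt ℂ (fun w => (w - ρ)⁻¹) z :=
  (analyticAt_id.sub analyticAt_const).inv (sub_ne_zero.2 h)

/-- Subtracting the principal parts at simple zeros of `g` from `1 / g` leaves an analytic
function. -/
lemma exists_analyticAt_inv_sub_sum {g : ℂ → ℂ} (hg : Differentiable ℂ g) {Z : Finset ℂ}
    (hZ : ∀ ρ ∈ Z, g ρ = 0) (hZ' : ∀ ρ ∈ Z, deriv g ρ ≠ 0) {K : Set ℂ}
    (hK : ∀ z ∈ K, g z = 0 → z ∈ Z) :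
    ∃ G : ℂ → ℂ, (∀ z ∈ K, AnalyticAt ℂ G z) ∧
      ∀ z, z ∉ Z → G z = (g z)⁻¹ - ∑ ρ ∈ Z, (deriv g ρ)⁻¹ * (z - ρ)⁻¹ := by
  classical
  let P : Finset ℂ → ℂ → ℂ := fun A z => ∑ ρ ∈ A, (deriv g ρ)⁻¹ * (z - ρ)⁻¹
  have hP : ∀ (A : Finset ℂ) (z : ℂ), z ∉ A → AnalyticAt ℂ (P A) z := fun A z hz =>
    Finset.analyticAt_fun_sum _ fun ρ hρ =>
      analyticAt_const.mul (analyticAt_inv_sub fun h => hz (h ▸ hρ))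
  -- Near a zero z, 1/g = k(w) / (w - z) with k the reciprocal of the slope of g and k(z) = 1/g'(z);
  -- removing the pole leaves the slope of k, whose value at z fills the hole.
  let G : ℂ → ℂ := fun z => if z ∈ Z then
    dslope (fun w => (dslope g z w)⁻¹) z z - P (Z.erase z) z else (g z)⁻¹ - P Z z
  refine ⟨G, fun z hz => ?_, fun z hz => if_neg hz⟩
  by_cases hzZ : z ∈ Z
  · have hs : AnalyticAt ℂ (dslope g z) z := analyticAt_dslope (hg.analyticAt z)
    have hs0 : dslope g z z ≠ 0 := by rw [dslope_same]; exact hZ' z hzZ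
    have hk : AnalyticAt ℂ (fun w => (dslope g z w)⁻¹) z := hs.inv hs0
    have hrep : AnalyticAt ℂ
        (fun w => dslope (fun w => (dslope g z w)⁻¹) z w - P (Z.erase z) w) z :=
      (analyticAt_dslope hk).sub (hP _ _ (Finset.notMem_erase z Z))
    refine hrep.congr ?_
    have h1 : ∀ᶠ w in 𝓝 z, w ∉ Z.erase z :=
      (Z.erase z).finite_toSet.isClosed.isOpen_compl.mem_nhds (by simp)
    filter_upwards [h1, hs.continuousAt.eventually_ne hs0] with w hw hws
    by_cases hwz : w = z
    · subst hwz
      exact (if_pos hzZ).symm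
    · have hwZ : w ∉ Z := fun h => hw (Finset.mem_erase.2 ⟨hwz, h⟩)
      have hne : w - z ≠ 0 := sub_ne_zero.2 hwz
      have hgw : g w = (w - z) * dslope g z w := by
        have := sub_smul_dslope g z w
        rw [hZ z hzZ, sub_zero, smul_eq_mul] at this
        exact this.symm
      have hsum : P Z w = (deriv g z)⁻¹ * (w - z)⁻¹ + P (Z.erase z) w :=
        (Finset.add_sum_erase Z _ hzZ).symm
      simp only [G, if_neg hwZ]
      rw [dslope_of_ne _ hwz, slope_def_field, dslope_same, hsum, hgw]
      have := hZ' z hzZ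
      field_simp
      ring
  · have hgz : g z ≠ 0 := fun h => hzZ (hK z hz h)
    have hrep : AnalyticAt ℂ (fun w => (g w)⁻¹ - P Z w) z :=
      ((hg.analyticAt z).inv hgz).sub (hP _ _ hzZ)
    refine hrep.congr ?_
    filter_upwards [Z.finite_toSet.isClosed.isOpen_compl.mem_nhds
      (show z ∈ (Z : Set ℂ)ᶜ by simpa using hzZ)] with w hw
    exact (if_neg (by simpa using hw)).symm

lemma circleIntegral_pow_mul_inv_sub {R : ℝ} {ρ : ℂ} (hρ : ‖ρ‖ < R) (m : ℕ) :
    (∮ z in C(0, R), z ^ m * (z - ρ)⁻¹) = 2 * Real.pi * Complex.I * ρ ^ m := by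
  have h : DiffContOnCl ℂ (fun z : ℂ => z ^ m) (Metric.ball 0 R) :=
    (differentiable_pow m).diffContOnCl
  have := h.circleIntegral_sub_inv_smul (mem_ball_zero_iff.2 hρ)
  simpa [mul_comm] using this

lemma circleIntegrable_inv_pow_mul_inv_sub {R : ℝ} {ρ : ℂ} (hρ : ‖ρ‖ < R) (n : ℕ) :
    CircleIntegrable (fun z => (z ^ n)⁻¹ * (z - ρ)⁻¹) 0 R := by
  refine ContinuousOn.circleIntegrable ((norm_nonneg ρ).trans hρ.le) fun z hz => ?_
  have hz' : ‖z‖ = R := mem_sphere_zero_iff_norm.1 hz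
  have h0 : z ≠ 0 := by
    rintro rfl
    rw [norm_zero] at hz'
    linarith [norm_nonneg ρ]
  have h1 : z - ρ ≠ 0 := sub_ne_zero.2 fun h => by rw [h] at hz'; linarith
  exact (((continuousAt_id.pow n).inv₀ (pow_ne_zero n h0)).mul
    ((continuousAt_id.sub continuousAt_const).inv₀ h1)).continuousWithinAt

/-- The residues at 0 and ρ cancel. The exponent is lowered by the partial fraction 1/(z^(n+1)(z -
ρ)) = (1/(z^n(z - ρ)) - 1/z^(n+1)) / ρ. -/
lemma circleIntegral_inv_pow_mul_inv_sub {R : ℝ} {ρ : ℂ} (hρ0 : ρ ≠ 0) (hρ : ‖ρ‖ < R) (n : ℕ) :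
    (∮ z in C(0, R), (z ^ (n + 1))⁻¹ * (z - ρ)⁻¹) = 0 := by
  have hR : 0 < R := (norm_nonneg ρ).trans_lt hρ
  have key : ∀ n : ℕ, (∮ z in C(0, R), (z ^ (n + 1))⁻¹ * (z - ρ)⁻¹) =
      ρ⁻¹ * ((∮ z in C(0, R), (z ^ n)⁻¹ * (z - ρ)⁻¹) - ∮ z in C(0, R), (z ^ (n + 1))⁻¹) := by
    intro n
    have hi : CircleIntegrable (fun z : ℂ => (z ^ (n + 1))⁻¹) 0 R := by
      refine ContinuousOn.circleIntegrable hR.le fun z hz => ?_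
      have h0 : z ≠ 0 := by
        rintro rfl
        simp only [mem_sphere_iff_norm, sub_self, norm_zero] at hz
        linarith
      exact ((continuousAt_id.pow _).inv₀ (pow_ne_zero _ h0)).continuousWithinAt
    rw [← circleIntegral.integral_sub (circleIntegrable_inv_pow_mul_inv_sub hρ n) hi,
      ← circleIntegral.integral_const_mul]
    refine circleIntegral.integral_congr hR.le fun z hz => ?_
    have hz' : ‖z‖ = R := mem_sphere_zero_iff_norm.1 hz
    have h0 : z ≠ 0 := by
      rintro rfl
      rw [norm_zero] at hz'
      linarith
    have h1 : z - ρ ≠ 0 := sub_ne_zero.2 fun h => by rw [h] at hz'; linarith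
    field_simp
    ring
  induction n with
  | zero =>
    rw [key]
    have h1 := circleIntegral_pow_mul_inv_sub hρ 0
    have h2 := circleIntegral.integral_sub_inv_of_mem_ball (c := 0) (w := 0) (R := R)
      (Metric.mem_ball_self hR)
    simp only [pow_zero, one_mul, mul_one, sub_zero] at h1 h2
    simp [h1, h2]
  | succ n ih =>
    rw [key, ih]
    have h := circleIntegral.integral_sub_zpow_of_ne (n := -((n + 1 + 1 : ℕ) : ℤ))
      (by push_cast; omega) 0 0 R
    simp only [sub_zero, zpow_neg, zpow_natCast] at h
    rw [h]
    simp

lemma iteratedDeriv_inv_sub (n : ℕ) (ρ : ℂ) :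
    iteratedDeriv n (fun z => (z - ρ)⁻¹) 0 = -(n.factorial / ρ ^ (n + 1)) := by
  have h := congrFun (iteratedDeriv_comp_sub_const n (fun z : ℂ => z⁻¹) ρ) 0
  rw [h, iteratedDeriv_eq_iterate]
  have h2 := iter_deriv_inv n (0 - ρ)
  rw [show (fun z : ℂ => z⁻¹) = Inv.inv from rfl, h2, zero_sub,
    show (-1 - (n : ℤ)) = -((n + 1 : ℕ) : ℤ) by push_cast; ring, zpow_neg, zpow_natCast,
    neg_pow ρ, pow_succ (-1 : ℂ)]
  have : ((-1 : ℂ) ^ n) ≠ 0 := by simp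
  by_cases hρ : ρ = 0
  · simp [hρ]
  field_simp

lemma circleIntegral_mul_sum {R : ℝ} (hR : 0 < R) {φ G f : ℂ → ℂ} {c : ℂ → ℂ} {Z : Finset ℂ}
    (hφ : ContinuousOn φ (Metric.sphere 0 R)) (hG : ContinuousOn G (Metric.sphere 0 R))
    (hZR : ∀ ρ ∈ Z, ‖ρ‖ < R)
    (hf : ∀ z, z ∉ Z → G z = f z - ∑ ρ ∈ Z, c ρ * (z - ρ)⁻¹) :
    (∮ z in C(0, R), φ z * f z) = (∮ z in C(0, R), φ z * G z) +
      ∑ ρ ∈ Z, c ρ * ∮ z in C(0, R), φ z * (z - ρ)⁻¹ := by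
  have hi : ∀ ρ ∈ Z, CircleIntegrable (fun z => φ z * (z - ρ)⁻¹) 0 R := fun ρ hρ =>
    (hφ.mul fun z hz => ((continuousAt_id.sub continuousAt_const).inv₀
      (sub_ne_zero.2 fun h => by
        have h1 : ‖z‖ = R := mem_sphere_zero_iff_norm.1 hz
        have h2 := hZR ρ hρ
        rw [← show z = ρ from h] at h2
        linarith)).continuousWithinAt).circleIntegrable hR.le
  have h1 : (∮ z in C(0, R), φ z * f z) = ∮ z in C(0, R),
      (φ z * G z + ∑ ρ ∈ Z, c ρ * (φ z * (z - ρ)⁻¹)) := by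
    refine circleIntegral.integral_congr hR.le fun z hz => ?_
    have hzZ : z ∉ Z := fun h => by
      have h1 : ‖z‖ = R := mem_sphere_zero_iff_norm.1 hz
      linarith [hZR z h]
    simp only [hf z hzZ]
    rw [mul_sub, Finset.mul_sum, sub_add, sub_eq_self.2]
    rw [← Finset.sum_sub_distrib]
    exact Finset.sum_eq_zero fun ρ _ => by ring
  have hi' : ∀ ρ ∈ Z, CircleIntegrable (fun z => c ρ * (φ z * (z - ρ)⁻¹)) 0 R :=
    fun ρ hρ => (hi ρ hρ).const_fun_smul
  have hsum : CircleIntegrable (fun z => ∑ ρ ∈ Z, c ρ * (φ z * (z - ρ)⁻¹)) 0 R :=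
    CircleIntegrable.fun_sum _ hi'
  have hGi : CircleIntegrable (fun z => φ z * G z) 0 R := (hφ.mul hG).circleIntegrable hR.le
  rw [h1, circleIntegral.integral_add hGi hsum, circleIntegral.integral_fun_sum hi']
  simp_rw [circleIntegral.integral_const_mul]

/-- The residue theorem for `z ^ m / g z`, when `g` has simple zeros. -/
lemma circleIntegral_pow_mul_inv {g : ℂ → ℂ} (hg : Differentiable ℂ g) {Z : Finset ℂ} {R : ℝ}
    (hR : 0 < R) (hZ : ∀ ρ ∈ Z, g ρ = 0) (hZ' : ∀ ρ ∈ Z, deriv g ρ ≠ 0)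
    (hZR : ∀ ρ ∈ Z, ‖ρ‖ < R) (hK : ∀ z ∈ Metric.closedBall (0 : ℂ) R, g z = 0 → z ∈ Z) (m : ℕ) :
    (∮ z in C(0, R), z ^ m * (g z)⁻¹) =
      2 * Real.pi * Complex.I * ∑ ρ ∈ Z, (deriv g ρ)⁻¹ * ρ ^ m := by
  obtain ⟨G, hGa, hG⟩ := exists_analyticAt_inv_sub_sum hg hZ hZ' hK
  have hGd : DifferentiableOn ℂ G (Metric.closedBall 0 R) := fun z hz =>
    (hGa z hz).differentiableAt.differentiableWithinAt
  have h0 : (∮ z in C(0, R), z ^ m * G z) = 0 :=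
    DiffContOnCl.circleIntegral_eq_zero hR.le
      (((differentiable_pow m).differentiableOn.mul hGd).diffContOnCl_ball subset_rfl)
  rw [circleIntegral_mul_sum hR (by fun_prop)
    (hGd.continuousOn.mono Metric.sphere_subset_closedBall) hZR hG, h0, zero_add, Finset.mul_sum]
  refine Finset.sum_congr rfl fun ρ hρ => ?_
  rw [circleIntegral_pow_mul_inv_sub (hZR ρ hρ)]
  ring

/-- The Taylor coefficients at `0` of `1 / g`, when `g` has simple zeros. -/
lemma circleIntegral_inv_pow_mul_inv {g : ℂ → ℂ} (hg : Differentiable ℂ g) {Z : Finset ℂ} {R : ℝ}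
    (hR : 0 < R) (hZ : ∀ ρ ∈ Z, g ρ = 0) (hZ' : ∀ ρ ∈ Z, deriv g ρ ≠ 0)
    (hZR : ∀ ρ ∈ Z, ‖ρ‖ < R) (hK : ∀ z ∈ Metric.closedBall (0 : ℂ) R, g z = 0 → z ∈ Z)
    (hg0 : g 0 ≠ 0) (n : ℕ) :
    (∮ z in C(0, R), (z ^ (n + 1))⁻¹ * (g z)⁻¹) = 2 * Real.pi * Complex.I *
      (iteratedDeriv n (fun z => (g z)⁻¹) 0 / n.factorial +
        ∑ ρ ∈ Z, (deriv g ρ)⁻¹ / ρ ^ (n + 1)) := by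
  obtain ⟨G, hGa, hG⟩ := exists_analyticAt_inv_sub_sum hg hZ hZ' hK
  have hGd : DifferentiableOn ℂ G (Metric.closedBall 0 R) := fun z hz =>
    (hGa z hz).differentiableAt.differentiableWithinAt
  have h0Z : (0 : ℂ) ∉ Z := fun h => hg0 (hZ 0 h)
  have hne : ∀ ρ ∈ Z, ρ ≠ 0 := fun ρ hρ h => h0Z (h ▸ hρ)
  have hφ : ContinuousOn (fun z : ℂ => (z ^ (n + 1))⁻¹) (Metric.sphere 0 R) := fun z hz => by
    have h0 : z ≠ 0 := by
      rintro rfl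
      rw [mem_sphere_zero_iff_norm, norm_zero] at hz
      exact hR.ne hz
    exact ((continuousAt_id.pow _).inv₀ (pow_ne_zero _ h0)).continuousWithinAt
  rw [circleIntegral_mul_sum hR hφ (hGd.continuousOn.mono Metric.sphere_subset_closedBall) hZR hG,
    Finset.sum_eq_zero fun ρ hρ => by
      rw [circleIntegral_inv_pow_mul_inv_sub (hne ρ hρ) (hZR ρ hρ), mul_zero], add_zero]
  have hC := (hGd.diffContOnCl_ball subset_rfl).circleIntegral_one_div_sub_center_pow_smul hR n
  simp only [sub_zero, one_div, smul_eq_mul] at hC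
  rw [hC]
  -- The principal parts integrated to zero; the sum over the zeros now comes from their Taylor
  -- coefficients at 0, subtracted inside G.
  have hGe : G =ᶠ[𝓝 0]
      ((fun z => (g z)⁻¹) - fun z => ∑ ρ ∈ Z, (deriv g ρ)⁻¹ * (z - ρ)⁻¹) := by
    filter_upwards [Z.finite_toSet.isClosed.isOpen_compl.mem_nhds
      (show (0 : ℂ) ∈ (Z : Set ℂ)ᶜ by simpa using h0Z)] with w hw
    exact hG w (by simpa using hw)
  have ha : ∀ ρ ∈ Z, AnalyticAt ℂ (fun z => (deriv g ρ)⁻¹ * (z - ρ)⁻¹) 0 := fun ρ hρ =>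
    analyticAt_const.mul (analyticAt_inv_sub (hne ρ hρ).symm)
  have hgi : AnalyticAt ℂ (fun z => (g z)⁻¹) 0 := (hg.analyticAt 0).inv hg0
  rw [hGe.iteratedDeriv_eq, iteratedDeriv_sub hgi.contDiffAt
    (Finset.analyticAt_fun_sum _ ha).contDiffAt,
    iteratedDeriv_fun_sum fun ρ hρ => (ha ρ hρ).contDiffAt]
  have hs : ∑ ρ ∈ Z, iteratedDeriv n (fun z => (deriv g ρ)⁻¹ * (z - ρ)⁻¹) 0 =
      -(n.factorial * ∑ ρ ∈ Z, (deriv g ρ)⁻¹ / ρ ^ (n + 1)) := by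
    rw [Finset.mul_sum, ← Finset.sum_neg_distrib]
    refine Finset.sum_congr rfl fun ρ hρ => ?_
    rw [iteratedDeriv_const_mul_field, iteratedDeriv_inv_sub]
    ring
  rw [hs]
  have hf : (n.factorial : ℂ) ≠ 0 := by exact_mod_cast n.factorial_ne_zero
  field_simp
  ring


/-! ### The function Sin_q z / z and its zeros -/

/-- The entire function `Sin_q z / z`. -/
noncomputable def qSinc (q : ℝ) : ℂ → ℂ := dslope (qSin q) 0

lemma differentiable_qSinc {q : ℝ} (hq0 : 0 < q) (hq1 : q < 1) : Differentiable ℂ (qSinc q) := by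
  rw [← differentiableOn_univ]
  exact (Complex.differentiableOn_dslope univ_mem).2 (differentiable_qSin hq0 hq1).differentiableOn

lemma qSinc_zero {q : ℝ} (hq0 : 0 < q) (hq1 : q < 1) : qSinc q 0 = 1 := by
  rw [qSinc, dslope_same, deriv_qSin_zero hq0 hq1]

lemma qSinc_of_ne (q : ℝ) {z : ℂ} (hz : z ≠ 0) : qSinc q z = qSin q z / z := by
  rw [qSinc, dslope_of_ne _ hz, slope_def_field, qSin_zero, sub_zero, sub_zero]

lemma deriv_qSinc {q : ℝ} (hq0 : 0 < q) (hq1 : q < 1) {z : ℂ} (hz : z ≠ 0)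
    (hS : qSin q z = 0) : deriv (qSinc q) z = deriv (qSin q) z / z := by
  have h : qSinc q =ᶠ[𝓝 z] fun w => qSin q w / w :=
    (eventually_ne_nhds hz).mono fun w hw => qSinc_of_ne q hw
  have h2 := ((differentiable_qSin hq0 hq1 z).hasDerivAt).fun_div (hasDerivAt_id' z) hz
  rw [h.deriv_eq, h2.deriv, hS]
  field_simp
  ring

open Classical in
/-- The set of the zeros `±ξ_1, …, ±ξ_n`. -/
noncomputable def zeroSet (q : ℝ) (n : ℕ) : Finset ℂ :=
  (Finset.range n).image (fun k => (qSinZero q (k + 1) : ℂ)) ∪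
    (Finset.range n).image (fun k => -(qSinZero q (k + 1) : ℂ))

lemma mem_zeroSet {q : ℝ} {n : ℕ} {z : ℂ} : z ∈ zeroSet q n ↔
    ∃ k < n, z = qSinZero q (k + 1) ∨ z = -qSinZero q (k + 1) := by
  simp only [zeroSet, Finset.mem_union, Finset.mem_image, Finset.mem_range]
  constructor
  · rintro (⟨k, hk, rfl⟩ | ⟨k, hk, rfl⟩)
    · exact ⟨k, hk, Or.inl rfl⟩
    · exact ⟨k, hk, Or.inr rfl⟩
  · rintro ⟨k, hk, rfl | rfl⟩
    · exact Or.inl ⟨k, hk, rfl⟩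
    · exact Or.inr ⟨k, hk, rfl⟩

lemma sum_zeroSet {q : ℝ} (hq0 : 0 < q) (hq1 : q < 1) (n : ℕ) (φ : ℂ → ℂ) :
    ∑ ρ ∈ zeroSet q n, φ ρ =
      ∑ k ∈ Finset.range n, (φ (qSinZero q (k + 1)) + φ (-qSinZero q (k + 1))) := by
  classical
  have hinj : Function.Injective fun k : ℕ => (qSinZero q (k + 1) : ℂ) := fun a b hab => by
    have := (qSinZero_strictMono hq0 hq1).injective (Complex.ofReal_injective hab)
    omega
  have hinj' : Function.Injective fun k : ℕ => -(qSinZero q (k + 1) : ℂ) :=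
    neg_injective.comp hinj
  rw [zeroSet, Finset.sum_union, Finset.sum_image hinj.injOn, Finset.sum_image hinj'.injOn, Finset.sum_add_distrib]
  · rw [Finset.disjoint_left]
    intro z hz hz'
    obtain ⟨k, -, rfl⟩ := Finset.mem_image.1 hz
    obtain ⟨j, -, hj⟩ := Finset.mem_image.1 hz'
    have h1 := qSinZero_succ_pos hq0 hq1 k
    have h2 := qSinZero_succ_pos hq0 hq1 j
    have h3 : -qSinZero q (j + 1) = qSinZero q (k + 1) := by exact_mod_cast hj
    linarith

lemma qSinZero_ne_zero {q : ℝ} (hq0 : 0 < q) (hq1 : q < 1) (k : ℕ) :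
    (qSinZero q (k + 1) : ℂ) ≠ 0 :=
  Complex.ofReal_ne_zero.2 (qSinZero_succ_pos hq0 hq1 k).ne'

lemma zeroSet_spec {q : ℝ} (hq0 : 0 < q) (hq1 : q < 1) {n : ℕ} {ρ : ℂ} (hρ : ρ ∈ zeroSet q n) :
    ρ ≠ 0 ∧ qSin q ρ = 0 ∧ deriv (qSin q) ρ ≠ 0 := by
  obtain ⟨k, -, rfl | rfl⟩ := mem_zeroSet.1 hρ
  · exact ⟨qSinZero_ne_zero hq0 hq1 k, qSin_qSinZero hq0 hq1 _,
      deriv_qSin_qSinZero_ne_zero hq0 hq1 k⟩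
  · refine ⟨neg_ne_zero.2 (qSinZero_ne_zero hq0 hq1 k), ?_, ?_⟩
    · rw [qSin_neg, qSin_qSinZero hq0 hq1, neg_zero]
    · rw [deriv_qSin_neg]
      exact deriv_qSin_qSinZero_ne_zero hq0 hq1 k

/-- A radius between `ξ_n` and `ξ_{n+1}`. -/
noncomputable def radius (q : ℝ) (n : ℕ) : ℝ := thetaInv q ((n + 1 / 2) * Real.pi)

lemma le_radius {q : ℝ} (hq0 : 0 < q) (hq1 : q < 1) (n : ℕ) : (n : ℝ) + 1 ≤ radius q n := by
  refine le_trans ?_ (le_thetaInv hq0 hq1 (by positivity))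
  nlinarith [Real.pi_gt_three, (Nat.cast_nonneg n : (0 : ℝ) ≤ n)]

lemma one_le_radius {q : ℝ} (hq0 : 0 < q) (hq1 : q < 1) (n : ℕ) : 1 ≤ radius q n :=
  le_trans (by linarith [(Nat.cast_nonneg n : (0 : ℝ) ≤ n)]) (le_radius hq0 hq1 n)

lemma cos_theta_radius {q : ℝ} (hq0 : 0 < q) (hq1 : q < 1) (n : ℕ) :
    Real.cos (theta q (radius q n)) = 0 := by
  rw [radius, theta_thetaInv hq0 hq1, Real.cos_eq_zero_iff]
  exact ⟨n, by push_cast; ring⟩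

lemma qSinZero_lt_radius_iff {q : ℝ} (hq0 : 0 < q) (hq1 : q < 1) {k n : ℕ} :
    qSinZero q (k + 1) < radius q n ↔ k < n := by
  rw [qSinZero_eq hq0 hq1, radius, (thetaInv_strictMono hq0 hq1).lt_iff_lt,
    mul_lt_mul_iff_left₀ Real.pi_pos]
  constructor
  · intro h
    have h1 : (k : ℝ) < n := by push_cast at h; linarith
    exact_mod_cast h1
  · intro h
    have h1 : ((k + 1 : ℕ) : ℝ) ≤ n := by exact_mod_cast h
    linarith

lemma norm_lt_radius {q : ℝ} (hq0 : 0 < q) (hq1 : q < 1) {n : ℕ} {ρ : ℂ} (hρ : ρ ∈ zeroSet q n) :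
    ‖ρ‖ < radius q n := by
  obtain ⟨k, hk, rfl | rfl⟩ := mem_zeroSet.1 hρ
  · rw [Complex.norm_real, Real.norm_of_nonneg (qSinZero_succ_pos hq0 hq1 k).le]
    exact (qSinZero_lt_radius_iff hq0 hq1).2 hk
  · rw [norm_neg, Complex.norm_real, Real.norm_of_nonneg (qSinZero_succ_pos hq0 hq1 k).le]
    exact (qSinZero_lt_radius_iff hq0 hq1).2 hk

lemma mem_zeroSet_of_qSinc_eq_zero {q : ℝ} (hq0 : 0 < q) (hq1 : q < 1) {n : ℕ} {z : ℂ}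
    (hz : z ∈ Metric.closedBall (0 : ℂ) (radius q n)) (h : qSinc q z = 0) : z ∈ zeroSet q n := by
  have hz0 : z ≠ 0 := by
    rintro rfl
    rw [qSinc_zero hq0 hq1] at h
    exact one_ne_zero h
  rw [qSinc_of_ne q hz0, div_eq_zero_iff, or_iff_left hz0] at h
  rw [mem_closedBall_zero_iff] at hz
  have him := im_eq_zero_of_qSin_eq_zero hq0 hq1 h
  obtain ⟨x, rfl⟩ : ∃ x : ℝ, z = x := ⟨z.re, Complex.ext rfl (by simpa using him)⟩
  rw [Complex.norm_real, Real.norm_eq_abs] at hz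
  have key : ∀ y : ℝ, 0 < y → y ≤ radius q n → qSin q y = 0 →
      ∃ k < n, y = qSinZero q (k + 1) := by
    intro y hy0 hyR hy
    obtain ⟨k, rfl⟩ : y ∈ Set.range (fun k : ℕ => qSinZero q (k + 1)) := by
      rw [range_qSinZero hq0 hq1]; exact ⟨hy0, hy⟩
    refine ⟨k, (qSinZero_lt_radius_iff hq0 hq1).1 (lt_of_le_of_ne hyR fun he => ?_), rfl⟩
    -- No zero lies on the circle itself: sin θ and cos θ would both vanish there.
    have h1 := qSin_ofReal hq0 hq1 (radius q n)
    rw [← he, hy, eq_comm, mul_eq_zero, Complex.ofReal_eq_zero, Complex.ofReal_eq_zero,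
      or_iff_right (norm_ne_zero_iff.2 (qExpE_I_mul_ne_zero hq0 hq1 _)), he] at h1
    have h2 := Real.sin_sq_add_cos_sq (theta q (radius q n))
    rw [h1, cos_theta_radius hq0 hq1] at h2
    norm_num at h2
  rw [mem_zeroSet]
  rcases lt_or_gt_of_ne (Complex.ofReal_ne_zero.1 hz0) with hx | hx
  · obtain ⟨k, hk, he⟩ := key (-x) (by linarith) ((neg_le_abs x).trans hz)
      (by rw [Complex.ofReal_neg, qSin_neg, h, neg_zero])
    exact ⟨k, hk, Or.inr (by rw [← he]; simp)⟩
  · obtain ⟨k, hk, he⟩ := key x hx ((le_abs_self x).trans hz) h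
    exact ⟨k, hk, Or.inl (by rw [← he])⟩

/-! ### Vanishing contour integrals, convergence, and the residue sums -/

lemma tendsto_circleIntegral {q : ℝ} (hq0 : 0 < q) (hq1 : q < 1) {φ : ℂ → ℂ} (m : ℕ)
    (hφ : ∀ z : ℂ, 1 ≤ ‖z‖ → ‖φ z‖ ≤ ‖z‖ ^ m) :
    Tendsto (fun n => ∮ z in C(0, radius q n), φ z * (qSinc q z)⁻¹) atTop (𝓝 0) := by
  -- Of the three extra powers, one pays for the length of the circle, one for the numerator z of z
  -- / Sin_q z, and one gives decay.
  obtain ⟨C, hC, hS⟩ := exists_le_norm_qSin_of_cos_eq_zero hq0 hq1 (m + 3)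
  have hlim : Tendsto (fun n : ℕ => 2 * Real.pi / C * (1 / ((n : ℝ) + 1))) atTop (𝓝 0) := by
    simpa using (tendsto_one_div_add_atTop_nhds_zero_nat (𝕜 := ℝ)).const_mul (2 * Real.pi / C)
  refine squeeze_zero_norm (fun n => ?_) hlim
  have hR1 := one_le_radius hq0 hq1 n
  have hRn := le_radius hq0 hq1 n
  have hcos := cos_theta_radius hq0 hq1 n
  generalize radius q n = R at *
  have hR0 : 0 < R := by linarith
  refine (circleIntegral.norm_integral_le_of_norm_le_const hR0.le
    (C := R ^ m * (R / (C * R ^ (m + 3)))) fun z hz => ?_).trans ?_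
  · have hz' : ‖z‖ = R := mem_sphere_zero_iff_norm.1 hz
    have hz0 : z ≠ 0 := by rw [← norm_ne_zero_iff, hz']; exact hR0.ne'
    rw [norm_mul, qSinc_of_ne q hz0, inv_div, norm_div, hz']
    have h1 := hS R hR1 hcos z hz'
    have h2 := hφ z (by rw [hz']; exact hR1)
    rw [hz'] at h2
    gcongr
  · have e : 2 * Real.pi * R * (R ^ m * (R / (C * R ^ (m + 3)))) =
        2 * Real.pi / C * (1 / R) := by
      field_simp
      ring
    rw [e]
    gcongr

lemma norm_qEtaTerm_le {q : ℝ} (hq0 : 0 < q) (hq1 : q < 1) (s : ℂ) (k : ℕ) :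
    ‖qEtaTerm q s k‖ ≤
      4 / growthConst q (⌈-s.re⌉₊ + 4) * (1 / ((k + 1 : ℕ) : ℝ) ^ 2) := by
  -- The power x^M bounds |x^(-s)| for x ≥ 1. Of the four further powers, two absorb (1 + x)² and
  -- two make the series summable.
  set M := ⌈-s.re⌉₊
  have hk := le_qSinZero hq0 hq1 (k + 1)
  have hd := le_norm_deriv_qSin hq0 hq1 (M + 4) (qSin_qSinZero hq0 hq1 (k + 1))
  have hd0 := norm_pos_iff.2 (deriv_qSin_qSinZero_ne_zero hq0 hq1 k)
  have hg := growthConst_pos hq0 hq1 (M + 4)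
  have hk1 : (1 : ℝ) ≤ ((k + 1 : ℕ) : ℝ) := by simp
  rw [qEtaTerm]
  generalize qSinZero q (k + 1) = x at *
  have hx1 : 1 ≤ x := hk1.trans hk
  have hx0 : 0 < x := by linarith
  rw [abs_of_pos hx0] at hd
  have h1 : ‖1 / (x : ℂ) ^ s‖ ≤ x ^ M := by
    rw [norm_div, norm_one, Complex.norm_cpow_eq_rpow_re_of_pos hx0, one_div, ← Real.rpow_neg hx0.le,
      ← Real.rpow_natCast]
    exact Real.rpow_le_rpow_of_exponent_le hx1 (Nat.le_ceil _)
  have h2 : growthConst q (M + 4) * x ^ (M + 4) ≤ ‖deriv (qSin q) x‖ * (2 * x) ^ 2 :=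
    hd.trans (by gcongr; linarith)
  have h3 : growthConst q (M + 4) * x ^ M * x ^ 2 ≤ 4 * ‖deriv (qSin q) x‖ := by
    have : growthConst q (M + 4) * x ^ M * x ^ 2 * x ^ 2 ≤ 4 * ‖deriv (qSin q) x‖ * x ^ 2 := by
      calc _ = growthConst q (M + 4) * x ^ (M + 4) := by ring
        _ ≤ _ := h2
        _ = _ := by ring
    exact le_of_mul_le_mul_right this (by positivity)
  calc _ ≤ 1 / ‖deriv (qSin q) x‖ * x ^ M := by
        rw [norm_mul, norm_div, norm_one]
        gcongr
    _ ≤ 4 / growthConst q (M + 4) * (1 / x ^ 2) := by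
        rw [div_mul_div_comm, one_div_mul_eq_div, div_le_div_iff₀ hd0 (by positivity)]
        linarith
    _ ≤ _ := by gcongr

lemma summable_qEtaTerm {q : ℝ} (hq0 : 0 < q) (hq1 : q < 1) (s : ℂ) :
    Summable (qEtaTerm q s) := by
  refine Summable.of_norm_bounded ?_ (norm_qEtaTerm_le hq0 hq1 s)
  exact ((summable_nat_add_iff 1).2 (Real.summable_one_div_nat_pow.2 one_lt_two)).mul_left _

lemma sum_residues_pow {q : ℝ} (hq0 : 0 < q) (hq1 : q < 1) (j n : ℕ) :
    ∑ ρ ∈ zeroSet q n, (deriv (qSinc q) ρ)⁻¹ * ρ ^ (2 * j + 1) =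
      2 * ∑ k ∈ Finset.range n, qEtaTerm q (-(2 * ((j + 1 : ℕ) : ℂ))) k := by
  have h : ∀ ρ ∈ zeroSet q n, (deriv (qSinc q) ρ)⁻¹ * ρ ^ (2 * j + 1) =
      ρ ^ (2 * (j + 1)) / deriv (qSin q) ρ := fun ρ hρ => by
    obtain ⟨h0, h1, h2⟩ := zeroSet_spec hq0 hq1 hρ
    rw [deriv_qSinc hq0 hq1 h0 h1]
    field_simp
    ring
  rw [Finset.sum_congr rfl h, sum_zeroSet hq0 hq1, Finset.mul_sum]
  refine Finset.sum_congr rfl fun k _ => ?_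
  have e : (2 * ((j + 1 : ℕ) : ℂ)) = ((2 * (j + 1) : ℕ) : ℂ) := by push_cast; ring
  rw [deriv_qSin_neg, qEtaTerm, e, Complex.cpow_neg, Complex.cpow_natCast,
    (even_two_mul (j + 1)).neg_pow, one_div, one_div, inv_inv]
  ring

lemma sum_residues_inv_pow {q : ℝ} (hq0 : 0 < q) (hq1 : q < 1) (j n : ℕ) :
    ∑ ρ ∈ zeroSet q n, (deriv (qSinc q) ρ)⁻¹ / ρ ^ (2 * j + 1) =
      2 * ∑ k ∈ Finset.range n, qEtaTerm q (2 * (j : ℂ)) k := by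
  have h : ∀ ρ ∈ zeroSet q n, (deriv (qSinc q) ρ)⁻¹ / ρ ^ (2 * j + 1) =
      1 / deriv (qSin q) ρ * (1 / ρ ^ (2 * j)) := fun ρ hρ => by
    obtain ⟨h0, h1, h2⟩ := zeroSet_spec hq0 hq1 hρ
    rw [deriv_qSinc hq0 hq1 h0 h1]
    field_simp
    ring
  rw [Finset.sum_congr rfl h, sum_zeroSet hq0 hq1, Finset.mul_sum]
  refine Finset.sum_congr rfl fun k _ => ?_
  have e : (2 * (j : ℂ)) = ((2 * j : ℕ) : ℂ) := by push_cast; ring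
  rw [deriv_qSin_neg, qEtaTerm, e, Complex.cpow_natCast, (even_two_mul j).neg_pow]
  ring

lemma deriv_qSinc_ne_zero {q : ℝ} (hq0 : 0 < q) (hq1 : q < 1) {n : ℕ} {ρ : ℂ}
    (hρ : ρ ∈ zeroSet q n) : deriv (qSinc q) ρ ≠ 0 := by
  obtain ⟨h0, h1, h2⟩ := zeroSet_spec hq0 hq1 hρ
  rw [deriv_qSinc hq0 hq1 h0 h1]
  exact div_ne_zero h2 h0

lemma qSinc_eq_zero {q : ℝ} (hq0 : 0 < q) (hq1 : q < 1) {n : ℕ} {ρ : ℂ}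
    (hρ : ρ ∈ zeroSet q n) : qSinc q ρ = 0 := by
  obtain ⟨h0, h1, -⟩ := zeroSet_spec hq0 hq1 hρ
  rw [qSinc_of_ne q h0, h1, zero_div]

/-- The exponent 2j + 1 is nonnegative, so the integrand has no pole at 0 and the residues at ±ξ_k
alone sum to zero in the limit. -/
lemma qEta_neg_even {q : ℝ} (hq0 : 0 < q) (hq1 : q < 1) (j : ℕ) :
    qEta q (-(2 * ((j + 1 : ℕ) : ℂ))) = 0 := by
  have h1 := tendsto_circleIntegral hq0 hq1 (φ := fun z => z ^ (2 * j + 1)) (2 * j + 1)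
    (fun z _ => (norm_pow z _).le)
  simp_rw [fun n => circleIntegral_pow_mul_inv (differentiable_qSinc hq0 hq1)
    (zero_lt_one.trans_le (one_le_radius hq0 hq1 n)) (fun ρ hρ => qSinc_eq_zero hq0 hq1 hρ)
    (fun ρ hρ => deriv_qSinc_ne_zero hq0 hq1 hρ) (fun ρ hρ => norm_lt_radius hq0 hq1 hρ)
    (fun z hz => mem_zeroSet_of_qSinc_eq_zero hq0 hq1 hz) (2 * j + 1),
    sum_residues_pow hq0 hq1] at h1
  have hs := (summable_qEtaTerm hq0 hq1 (-(2 * ((j + 1 : ℕ) : ℂ)))).hasSum.tendsto_sum_nat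
  have h2 := ((hs.const_mul 2).const_mul (2 * Real.pi * Complex.I))
  have h3 := tendsto_nhds_unique h2 h1
  have hpi : (2 * Real.pi * Complex.I : ℂ) ≠ 0 := Complex.two_pi_I_ne_zero
  rw [mul_eq_zero, or_iff_right hpi, mul_eq_zero, or_iff_right two_ne_zero] at h3
  rw [qEta, h3, neg_zero]

/-- In the limit the Taylor coefficient plus twice the series vanishes; the minus sign in `qEta`
turns this into the equality. -/
lemma iteratedDeriv_inv_qSinc {q : ℝ} (hq0 : 0 < q) (hq1 : q < 1) (j : ℕ) :
    iteratedDeriv (2 * j) (fun z => (qSinc q z)⁻¹) 0 / (2 * j).factorial =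
      2 * qEta q (2 * (j : ℂ)) := by
  have h1 := tendsto_circleIntegral hq0 hq1 (φ := fun z => (z ^ (2 * j + 1))⁻¹) 0
    (fun z hz => by
      rw [norm_inv, norm_pow, pow_zero]
      exact inv_le_one_of_one_le₀ (one_le_pow₀ hz))
  simp_rw [fun n => circleIntegral_inv_pow_mul_inv (differentiable_qSinc hq0 hq1)
    (zero_lt_one.trans_le (one_le_radius hq0 hq1 n)) (fun ρ hρ => qSinc_eq_zero hq0 hq1 hρ)
    (fun ρ hρ => deriv_qSinc_ne_zero hq0 hq1 hρ) (fun ρ hρ => norm_lt_radius hq0 hq1 hρ)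
    (fun z hz => mem_zeroSet_of_qSinc_eq_zero hq0 hq1 hz)
    (by rw [qSinc_zero hq0 hq1]; exact one_ne_zero) (2 * j),
    sum_residues_inv_pow hq0 hq1] at h1
  have h2 := ((((summable_qEtaTerm hq0 hq1 (2 * (j : ℂ))).hasSum.tendsto_sum_nat.const_mul
    2).const_add (iteratedDeriv (2 * j) (fun z => (qSinc q z)⁻¹) 0 / (2 * j).factorial)).const_mul
    (2 * Real.pi * Complex.I))
  have h3 := tendsto_nhds_unique h2 h1
  have hpi : (2 * Real.pi * Complex.I : ℂ) ≠ 0 := Complex.two_pi_I_ne_zero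
  rw [mul_eq_zero, or_iff_right hpi] at h3
  rw [qEta]
  linear_combination h3

/-! ### The generating function at x = 1/2 and the even values -/

lemma iteratedDeriv_comp_mul_left (n : ℕ) (c : ℂ) (f : ℂ → ℂ) :
    iteratedDeriv n (fun t => f (c * t)) = fun t => c ^ n * iteratedDeriv n f (c * t) := by
  induction n with
  | zero => simp
  | succ n ih =>
    ext t
    rw [iteratedDeriv_succ, ih, deriv_const_mul_field, deriv_comp_mul_left, iteratedDeriv_succ,
      smul_eq_mul]
    ring

lemma qBernoulliGen_half_eventuallyEq {q : ℝ} (hq0 : 0 < q) (hq1 : q < 1) :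
    qBernoulliGen q (1 / 2) =ᶠ[𝓝 0] fun t => (qSinc q (-(Complex.I / 2) * t))⁻¹ := by
  have hc : ContinuousAt (fun t : ℂ => qExpE q (-(t / 2))) 0 :=
    ((differentiable_qExpE hq0 hq1).continuous.comp (by fun_prop)).continuousAt
  have h0 : qExpE q (-((0 : ℂ) / 2)) ≠ 0 := by simp [qExpE_zero]
  -- Near 0 the factor E_q(-t/2) is nonzero, so it cancels from numerator and denominator.
  filter_upwards [hc.eventually_ne h0] with t ht
  by_cases ht0 : t = 0
  · simp [ht0, qBernoulliGen, qSinc_zero hq0 hq1]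
  have hI : Complex.I * (-(Complex.I / 2) * t) = t / 2 := by
    linear_combination (-t / 2) * Complex.I_sq
  have he : qExpe q (t / 2) = 1 / qExpE q (-(t / 2)) := by
    rw [qExpe, qExpE]; congr 2; ring
  have hne : -(Complex.I / 2) * t ≠ 0 := by simp [ht0]
  rw [qBernoulliGen, if_neg ht0, mul_one_div, he, qSinc_of_ne q hne, qSin, hI, inv_div,
    div_div_eq_mul_div]
  have h1 : 1 / qExpE q (-(t / 2)) * qExpE q (t / 2) - 1 =
      (qExpE q (t / 2) - qExpE q (-(t / 2))) / qExpE q (-(t / 2)) := by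
    field_simp
  rw [h1, mul_one_div, div_div_div_cancel_right₀ ht]
  congr 1
  linear_combination t * Complex.I_sq

lemma qFact_ne_zero {q : ℝ} (hq0 : 0 < q) (hq1 : q < 1) (n : ℕ) : qFact q n ≠ 0 := by
  refine Finset.prod_ne_zero_iff.2 fun k hk => ?_
  have hk1 := (Finset.mem_Icc.1 hk).1
  have : q ^ k < 1 := pow_lt_one₀ hq0.le hq1 (by omega)
  exact div_ne_zero (by linarith) (by linarith)

lemma qBernoulliPoly_half_div {q : ℝ} (hq0 : 0 < q) (hq1 : q < 1) (n : ℕ) :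
    qBernoulliPoly q (2 * n) (1 / 2) / (qFact q (2 * n) : ℂ) =
      (-(Complex.I / 2)) ^ (2 * n) * (2 * qEta q (2 * (n : ℂ))) := by
  have hf : (qFact q (2 * n) : ℂ) ≠ 0 := Complex.ofReal_ne_zero.2 (qFact_ne_zero hq0 hq1 _)
  rw [qBernoulliPoly, mul_div_cancel_left₀ _ hf,
    (qBernoulliGen_half_eventuallyEq hq0 hq1).iteratedDeriv_eq,
    iteratedDeriv_comp_mul_left _ _ fun z => (qSinc q z)⁻¹, ← iteratedDeriv_inv_qSinc hq0 hq1]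
  simp only [mul_zero, mul_div_assoc]

lemma qEta_even {q : ℝ} (hq0 : 0 < q) (hq1 : q < 1) (n : ℕ) :
    qEta q (2 * (n : ℂ)) = (2 : ℂ) ^ (2 * (n : ℤ) - 1) * (-1 : ℂ) ^ n *
        (qBernoulliPoly q (2 * n) (1 / 2) / (qFact q (2 * n) : ℂ)) := by
  have h1 : (-(Complex.I / 2)) ^ (2 * n) = (-1 : ℂ) ^ n / 4 ^ n := by
    rw [pow_mul, ← div_pow, neg_sq, div_pow, Complex.I_sq]
    norm_num
  have h2 : (2 : ℂ) ^ (2 * (n : ℤ) - 1) = 4 ^ n / 2 := by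
    rw [zpow_sub₀ two_ne_zero, zpow_one, zpow_mul, zpow_natCast]
    norm_num
  have h3 : ((-1 : ℂ) ^ n) * (-1) ^ n = 1 := by rw [← mul_pow]; simp
  rw [qBernoulliPoly_half_div hq0 hq1, h1, h2]
  have h4 : (4 : ℂ) ^ n ≠ 0 := pow_ne_zero n (by norm_num)
  field_simp
  linear_combination (-qEta q (2 * (n : ℂ))) * h3

end QEta

theorem mainTheorem6 (q : ℝ) (hq0 : 0 < q) (hq1 : q < 1) :
    -- `(ξ_k)_{k ≥ 1}` is the increasing enumeration of the positive zeros of `Sin_q`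
    StrictMono (qSinZero q) ∧
    Set.range (fun k : ℕ => qSinZero q (k + 1)) = {x : ℝ | 0 < x ∧ qSin q (x : ℂ) = 0} ∧
    -- these zeros are simple
    (∀ k : ℕ, deriv (qSin q) (qSinZero q (k + 1) : ℂ) ≠ 0) ∧
    -- the series defining `η_q(s)` converges absolutely for every complex `s`
    (∀ s : ℂ, Summable (qEtaTerm q s)) ∧
    -- the values at the nonnegative even integers
    (∀ n : ℕ, qEta q (2 * (n : ℂ)) =
      (2 : ℂ) ^ (2 * (n : ℤ) - 1) * (-1 : ℂ) ^ n *
        (qBernoulliPoly q (2 * n) (1 / 2) / (qFact q (2 * n) : ℂ))) ∧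
    -- the values at the negative even integers
    (∀ n : ℕ, 1 ≤ n → qEta q (-(2 * (n : ℂ))) = 0) := by
  refine ⟨QEta.qSinZero_strictMono hq0 hq1, QEta.range_qSinZero hq0 hq1,
    QEta.deriv_qSin_qSinZero_ne_zero hq0 hq1, QEta.summable_qEtaTerm hq0 hq1,
    QEta.qEta_even hq0 hq1, fun n hn => ?_⟩
  obtain ⟨j, rfl⟩ := Nat.exists_eq_add_of_le' hn
  exact QEta.qEta_neg_even hq0 hq1 j
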